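/- Let $M$ be a smooth $4$-dimensional manifold, let $a$ be a smooth pseudo-Riemannian metric and $b$ a smooth $1$-form on $M$. A Finsler spacetime is a triple $(M,\mathcal A,F)$ where $\mathcal A\subset TM$ is open and conic ($(x,y)\in\mathcal A$, $\lambda>0$ imply $(x,\lambda y)\in\mathcal A$) with nonempty fibres over every point of $M$, and $F:\mathcal A\to[0,\infty)$ is smooth, satisfies $F(x,\lambda y)=\lambda F(x,y)$ for $\lambda>0$, and has fundamental tensor $g_{ij}=\frac12\frac{\partial^2F^2}{\partial y^i\partial y^j}$ of Lorentzian signature (in either sign convention) at every point of $\mathcal A$. It is of Randers type, $F=\alpha+\beta$, if on $\mathcal A$ one has $a_{ij}(x)y^iy^j>0$ and $F(x,y)=\alpha(x,y)+\beta(x,y)$ with $\alpha=\sqrt{a_{ij}(x)y^iy^j}$ and $\beta=b_i(x)y^i$. In local coordinates $(x,y)$ induced by charts of $M$, put on $\mathcal A$ $$N^i_j=\tfrac14\,\frac{\partial}{\partial y^j}\Big(g^{ik}\Big(y^l\frac{\partial^2F^2}{\partial x^l\partial y^k}-\frac{\partial F^2}{\partial x^k}\Big)\Big),\qquad \delta_j=\frac{\partial}{\partial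 x^j}-N^m_j\frac{\partial}{\partial y^m},$$ $$R^i{}_{jk}=\delta_jN^i_k-\delta_kN^i_j,\qquad \mathrm{Ric}=R^i{}_{ij}\,y^j,\qquad R_{ij}=\tfrac12\,\frac{\partial^2\mathrm{Ric}}{\partial y^i\partial y^j}.$$ $F$ is Berwald if in every chart $N^i_j(x,y)=\Gamma^i_{jk}(x)\,y^k$ on $\mathcal A$ for some functions $\Gamma^i_{jk}$ of $x$ alone. A Berwald $F$ is a solution of the vacuum Finsler field equation if $$\Big(g^{ij}-\frac{3}{F^2}\,y^iy^j\Big)R_{ij}=0\qquad\text{on }\mathcal A .$$ $\alpha$ solves the vacuum Einstein equations if the Ricci tensor of the Levi-Civita connection of $a$ vanishes, and $\beta$ is parallel with respect to $\alpha$ if $\nabla_ib_j=0$ for that connection. Let $(M,\mathcal A,F)$ be a Finsler spacetime of Randers type, $F=\alpha+\beta$. Then the following are equivalent: 1. $F$ is Berwald and solves the vacuum Finsler field equation; 2. $\alpha$ solves the vacuum Einstein equations and $F$ is Berwald; 3. $\alpha$ solves the vacuum Einstein equations and $\beta$ is parallel with respect to $\alpha$. -/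

import Mathlib

open scoped Manifold ContDiff Matrix

noncomputable section

namespace RandersSpacetime

/-! ### Calculus in local coordinates

`x` denotes a point of an open subset of `ℝ⁴` (a chart domain), `y` the induced fibre coordinates
of a tangent vector. Functions of `(x, y)` are written in curried form. -/

/-- Coordinate space `ℝ⁴`. -/
abbrev Coord : Type := EuclideanSpace ℝ (Fin 4)

/-- The partial derivative `∂ᵢ f = ∂f/∂xⁱ` of a function of `x`. -/
def pd (i : Fin 4) (f : Coord → ℝ) : Coord → ℝ := fun x =>
  fderiv ℝ f x (EuclideanSpace.single i 1)

/-- The partial derivative `∂f/∂xⁱ` of a function of `(x, y)`. -/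
def dx (i : Fin 4) (f : Coord → Coord → ℝ) : Coord → Coord → ℝ := fun x y =>
  fderiv ℝ (fun x' => f x' y) x (EuclideanSpace.single i 1)

/-- The partial derivative `∂f/∂yⁱ` of a function of `(x, y)`. -/
def dy (i : Fin 4) (f : Coord → Coord → ℝ) : Coord → Coord → ℝ := fun x y =>
  fderiv ℝ (f x) y (EuclideanSpace.single i 1)

/-! ### Finsler geometry in local coordinates

In this section `F : Coord → Coord → ℝ` is the coordinate expression `F(x, y)` of a Finsler
function. -/

/-- The function `F²`. -/
def sqFun (F : Coord → Coord → ℝ) : Coord → Coord → ℝ := fun x y => F x y ^ 2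

/-- The fundamental tensor `g_{ij} = ∂²(F²/2) / ∂yⁱ∂yʲ`. -/
def fundamentalTensor (F : Coord → Coord → ℝ) (x y : Coord) : Matrix (Fin 4) (Fin 4) ℝ :=
  Matrix.of fun i j => dy i (dy j (fun x y => (1 / 2 : ℝ) * F x y ^ 2)) x y

/-- The Cartan nonlinear connection
`Nⁱⱼ = (1/4) ∂/∂yʲ ( g^{ik} ( yˡ ∂²F²/∂xˡ∂yᵏ - ∂F²/∂xᵏ ) )`. -/
def cartanConnection (F : Coord → Coord → ℝ) (i j : Fin 4) : Coord → Coord → ℝ := fun x y =>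
  (1 / 4 : ℝ) * dy j (fun x y => ∑ k, (fundamentalTensor F x y)⁻¹ i k *
    ((∑ l, y l * dx l (dy k (sqFun F)) x y) - dx k (sqFun F) x y)) x y

/-- The horizontal derivative `δⱼ f = ∂f/∂xʲ - Nᵐⱼ ∂f/∂yᵐ`. -/
def horizontalDeriv (F : Coord → Coord → ℝ) (j : Fin 4) (f : Coord → Coord → ℝ) :
    Coord → Coord → ℝ := fun x y =>
  dx j f x y - ∑ m, cartanConnection F m j x y * dy m f x y

/-- The curvature `Rⁱⱼₖ = δⱼ Nⁱₖ - δₖ Nⁱⱼ` of the Cartan nonlinear connection. -/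
def finslerCurvature (F : Coord → Coord → ℝ) (i j k : Fin 4) : Coord → Coord → ℝ := fun x y =>
  horizontalDeriv F j (cartanConnection F i k) x y -
    horizontalDeriv F k (cartanConnection F i j) x y

/-- The Finsler Ricci scalar `Ric = Rⁱᵢⱼ yʲ`. -/
def finslerRic (F : Coord → Coord → ℝ) : Coord → Coord → ℝ := fun x y =>
  ∑ i, ∑ j, finslerCurvature F i i j x y * y j

/-- The Finsler Ricci tensor `R_{ij} = (1/2) ∂²Ric / ∂yⁱ∂yʲ`. -/
def finslerRicciTensor (F : Coord → Coord → ℝ) (i j : Fin 4) : Coord → Coord → ℝ := fun x y =>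
  (1 / 2 : ℝ) * dy i (dy j (finslerRic F)) x y

/-- Lorentzian signature, in either of the two sign conventions `(+,-,-,-)` and `(-,+,+,+)`. -/
def IsLorentzian (g : Matrix (Fin 4) (Fin 4) ℝ) : Prop :=
  ∃ P : Matrix (Fin 4) (Fin 4) ℝ, IsUnit P.det ∧
    (Pᵀ * g * P = Matrix.diagonal ![1, -1, -1, -1] ∨
      Pᵀ * g * P = Matrix.diagonal ![-1, 1, 1, 1])

/-! ### Pseudo-Riemannian geometry in local coordinates

In this section `a : Coord → Matrix (Fin 4) (Fin 4) ℝ` is the component matrix of a metric. -/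

/-- The Christoffel symbols `Γⁱⱼₖ = (1/2) a^{il} (∂ⱼ a_{lk} + ∂ₖ a_{lj} - ∂ₗ a_{jk})` of the
Levi-Civita connection. -/
def christoffel (a : Coord → Matrix (Fin 4) (Fin 4) ℝ) (i j k : Fin 4) : Coord → ℝ := fun x =>
  (1 / 2 : ℝ) * ∑ l, (a x)⁻¹ i l *
    (pd j (fun x => a x l k) x + pd k (fun x => a x l j) x - pd l (fun x => a x j k) x)

/-- The Riemann tensor
`R̄ₗⁱⱼₖ = ∂ⱼ Γⁱₖₗ - ∂ₖ Γⁱⱼₗ + Γⁱₘⱼ Γᵐₖₗ - Γⁱₘₖ Γᵐⱼₗ` of the Levi-Civita connection. -/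
def riemann (a : Coord → Matrix (Fin 4) (Fin 4) ℝ) (l i j k : Fin 4) : Coord → ℝ := fun x =>
  pd j (christoffel a i k l) x - pd k (christoffel a i j l) x +
    ∑ m, (christoffel a i m j x * christoffel a m k l x -
      christoffel a i m k x * christoffel a m j l x)

/-- The Ricci tensor `R̄ₗₖ = R̄ₗⁱᵢₖ`. -/
def ricci (a : Coord → Matrix (Fin 4) (Fin 4) ℝ) (l k : Fin 4) : Coord → ℝ := fun x =>
  ∑ i, riemann a l i i k x

/-! ### Global objects on a 4-manifold

A chart is an element of the maximal smooth atlas. -/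

variable {M : Type*} [TopologicalSpace M] [ChartedSpace Coord M]

/-- The tangent vector with coordinates `(x, y)` in the chart `e`, that is, the vector
`yⁱ ∂/∂xⁱ` at the point of `M` with coordinates `x`. -/
def ofCoord (e : OpenPartialHomeomorph M Coord) (x y : Coord) : TangentBundle (𝓡 4) M :=
  ⟨e.symm x, mfderiv (𝓡 4) (𝓡 4) e.symm x y⟩

/-- The coordinate expression in the chart `e` of a function on the tangent bundle. -/
def inChart (e : OpenPartialHomeomorph M Coord) (F : TangentBundle (𝓡 4) M → ℝ) :
    Coord → Coord → ℝ := fun x y => F (ofCoord e x y)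

variable (M) in
/-- A smooth pseudo-Riemannian metric on `M`: a nondegenerate symmetric bilinear form of arbitrary
signature on every tangent space, with smooth components in every chart. -/
structure PseudoRiemannianMetric where
  /-- The bilinear form on the tangent space at a point. -/
  form : ∀ p : M, TangentSpace (𝓡 4) p →L[ℝ] TangentSpace (𝓡 4) p →L[ℝ] ℝ
  symm : ∀ (p : M) (v w : TangentSpace (𝓡 4) p), form p v w = form p w v
  nondegenerate : ∀ (p : M) (v : TangentSpace (𝓡 4) p), (∀ w, form p v w = 0) → v = 0
  smooth : ∀ e ∈ IsManifold.maximalAtlas (𝓡 4) ∞ M, ∀ i j : Fin 4,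
    ContDiffOn ℝ ∞ (fun x => form (e.symm x)
      (mfderiv (𝓡 4) (𝓡 4) e.symm x (EuclideanSpace.single i (1 : ℝ)))
      (mfderiv (𝓡 4) (𝓡 4) e.symm x (EuclideanSpace.single j (1 : ℝ)))) e.target

/-- The component matrix `a_{ij}` of a metric in the chart `e`. -/
def PseudoRiemannianMetric.components (a : PseudoRiemannianMetric M)
    (e : OpenPartialHomeomorph M Coord) (x : Coord) : Matrix (Fin 4) (Fin 4) ℝ :=
  Matrix.of fun i j => a.form (e.symm x)
    (mfderiv (𝓡 4) (𝓡 4) e.symm x (EuclideanSpace.single i (1 : ℝ)))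
    (mfderiv (𝓡 4) (𝓡 4) e.symm x (EuclideanSpace.single j (1 : ℝ)))

variable (M) in
/-- A smooth 1-form on `M`. -/
structure OneForm where
  /-- The linear form on the tangent space at a point. -/
  form : ∀ p : M, TangentSpace (𝓡 4) p →L[ℝ] ℝ
  smooth : ∀ e ∈ IsManifold.maximalAtlas (𝓡 4) ∞ M, ∀ i : Fin 4,
    ContDiffOn ℝ ∞ (fun x => form (e.symm x)
      (mfderiv (𝓡 4) (𝓡 4) e.symm x (EuclideanSpace.single i (1 : ℝ)))) e.target

/-- The components `bᵢ` of a 1-form in the chart `e`. -/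
def OneForm.components (b : OneForm M) (e : OpenPartialHomeomorph M Coord) (i : Fin 4)
    (x : Coord) : ℝ :=
  b.form (e.symm x) (mfderiv (𝓡 4) (𝓡 4) e.symm x (EuclideanSpace.single i (1 : ℝ)))

/-- `(M, A, F)` is a Finsler spacetime: `A` is an open conic subset of `TM` with nonempty fibres,
and `F : A → [0, ∞)` is smooth, positively homogeneous of degree one, with fundamental tensor of
Lorentzian signature on `A`. Only the values of `F` on `A` matter. -/
structure IsFinslerSpacetime [IsManifold (𝓡 4) ∞ M]
    (A : Set (TangentBundle (𝓡 4) M)) (F : TangentBundle (𝓡 4) M → ℝ) : Prop where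
  isOpen : IsOpen A
  conic : ∀ (p : M) (v : TangentSpace (𝓡 4) p) (c : ℝ), 0 < c →
    (⟨p, v⟩ : TangentBundle (𝓡 4) M) ∈ A → (⟨p, c • v⟩ : TangentBundle (𝓡 4) M) ∈ A
  fiber_nonempty : ∀ p : M, ∃ v : TangentSpace (𝓡 4) p, (⟨p, v⟩ : TangentBundle (𝓡 4) M) ∈ A
  smooth : ContMDiffOn (𝓡 4).tangent 𝓘(ℝ, ℝ) ∞ F A
  nonneg : ∀ v ∈ A, 0 ≤ F v
  homogeneous : ∀ (p : M) (v : TangentSpace (𝓡 4) p) (c : ℝ), 0 < c →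
    (⟨p, v⟩ : TangentBundle (𝓡 4) M) ∈ A → F ⟨p, c • v⟩ = c * F ⟨p, v⟩
  lorentzian : ∀ e ∈ IsManifold.maximalAtlas (𝓡 4) ∞ M, ∀ x ∈ e.target, ∀ y : Coord,
    ofCoord e x y ∈ A → IsLorentzian (fundamentalTensor (inChart e F) x y)

/-- `F = α + β` on `A`, where `α = √(a(y, y))` (with `a(y, y) > 0` on `A`, so that `α` is real and
smooth there) and `β = b(y)`. -/
def IsRanders (A : Set (TangentBundle (𝓡 4) M)) (F : TangentBundle (𝓡 4) M → ℝ)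
    (a : PseudoRiemannianMetric M) (b : OneForm M) : Prop :=
  ∀ (p : M) (v : TangentSpace (𝓡 4) p), (⟨p, v⟩ : TangentBundle (𝓡 4) M) ∈ A →
    0 < a.form p v v ∧ F ⟨p, v⟩ = √(a.form p v v) + b.form p v

/-- `F` is of Berwald type: in every chart the Cartan nonlinear connection is linear on `A`,
`Nⁱⱼ(x, y) = Γⁱⱼₖ(x) yᵏ`. -/
def IsBerwald (A : Set (TangentBundle (𝓡 4) M)) (F : TangentBundle (𝓡 4) M → ℝ) : Prop :=
  ∀ e ∈ IsManifold.maximalAtlas (𝓡 4) ∞ M, ∃ Γ : Fin 4 → Fin 4 → Fin 4 → Coord → ℝ,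
    ∀ x ∈ e.target, ∀ y : Coord, ofCoord e x y ∈ A →
      ∀ i j, cartanConnection (inChart e F) i j x y = ∑ k, Γ i j k x * y k

/-- The vacuum field equation of Finsler gravity for Berwald spacetimes:
`(g^{ij} - (3 / F²) yⁱ yʲ) R_{ij} = 0` on `A`, with `R_{ij}` the Finsler Ricci tensor. -/
def SolvesFinslerVacuum (A : Set (TangentBundle (𝓡 4) M)) (F : TangentBundle (𝓡 4) M → ℝ) :
    Prop :=
  ∀ e ∈ IsManifold.maximalAtlas (𝓡 4) ∞ M, ∀ x ∈ e.target, ∀ y : Coord, ofCoord e x y ∈ A →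
    ∑ i, ∑ j, ((fundamentalTensor (inChart e F) x y)⁻¹ i j -
      3 / inChart e F x y ^ 2 * (y i * y j)) * finslerRicciTensor (inChart e F) i j x y = 0

/-- The vacuum Einstein equations: the Ricci tensor of `a` vanishes. -/
def SolvesEinsteinVacuum (a : PseudoRiemannianMetric M) : Prop :=
  ∀ e ∈ IsManifold.maximalAtlas (𝓡 4) ∞ M, ∀ x ∈ e.target, ∀ i j,
    ricci (a.components e) i j x = 0

/-- `b` is parallel with respect to the Levi-Civita connection of `a`:
`∇ᵢ bⱼ = ∂ᵢ bⱼ - Γᵏᵢⱼ bₖ = 0`. -/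
def IsParallel (a : PseudoRiemannianMetric M) (b : OneForm M) : Prop :=
  ∀ e ∈ IsManifold.maximalAtlas (𝓡 4) ∞ M, ∀ x ∈ e.target, ∀ i j,
    pd i (b.components e j) x -
      ∑ k, christoffel (a.components e) k i j x * b.components e k x = 0

end RandersSpacetime

end

namespace RandersSpacetime

/-! ### Directional derivatives of smooth functions -/

section General

variable {E : Type*} [NormedAddCommGroup E] [NormedSpace ℝ E]

/-! The argument is local, in a chart. Two facts drive it.

The first is that `F` is constant along the horizontal directions of its Cartan connection: `Nᵐᵢ
∂F/∂yᵐ = ∂F/∂xⁱ` (`sum_cartanConnection_mul_dy`). The second is that `α` is irrational over the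
functions analytic in `y`: a relation `α p₁ = p₂` on a fibre forces `p₁ = p₂ = 0`
(`eq_zero_of_sqrt_mul_eq`). The second fact needs `a` to take a negative value, and the Lorentzian
signature of `g` provides one (`exists_quad_neg`).

If `F` is Berwald, putting `N = Γ y` and `F = α + β` into the first fact gives `α · (linear in y) =
(quadratic in y)`. Both sides vanish, which says that `Γ` preserves `a` and `b`. As `Γ` is a second
`y`-derivative of the spray it is symmetric, hence it is the Levi-Civita connection and `β` is
parallel. Conversely, if `β` is parallel, the Levi-Civita connection preserves `F`, and this
determines the spray, so that `N` is the Levi-Civita connection (`isBerwaldOn_of_parallel`).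

In the Berwald case the Finsler Ricci tensor is therefore the Ricci tensor of `a`
(`finslerRicciTensor_eq`), so Ricci-flatness implies the field equation at once. For the converse,
the inverse of `g` is explicit, and its terms mixing `y` with `b♯` drop out because `Ric(b♯, ·) = 0`
for parallel `b`. The field equation again takes the form `α p₁ = p₂`. Its two halves make `Ric`
proportional to the trace of `Ric` times `a`, with a factor that dimension 4 excludes unless `Ric =
0` (`ricci_eq_zero_of_vacuum`). -/

theorem contDiffOn_fderiv_apply {f : E → ℝ} {s : Set E} (hs : IsOpen s)
    (hf : ContDiffOn ℝ ∞ f s) (v : E) : ContDiffOn ℝ ∞ (fun x => fderiv ℝ f x v) s :=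
  (hf.fderiv_of_isOpen hs (by simp)).clm_apply contDiffOn_const

theorem fderiv_fderiv_apply_comm {f : E → ℝ} {s : Set E} (hs : IsOpen s)
    (hf : ContDiffOn ℝ ∞ f s) {x : E} (hx : x ∈ s) (v w : E) :
    fderiv ℝ (fun z => fderiv ℝ f z v) x w = fderiv ℝ (fun z => fderiv ℝ f z w) x v := by
  have hc : ContDiffAt ℝ ∞ f x := hf.contDiffAt (hs.mem_nhds hx)
  have hd : DifferentiableAt ℝ (fderiv ℝ f) x :=
    ((hf.fderiv_of_isOpen hs (m := ∞) (by simp)).contDiffAt (hs.mem_nhds hx)).differentiableAt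
      (by simp)
  -- Evaluation at `u` is linear, so this derivative is the second derivative with its second
  -- argument frozen at `u`.
  have key : ∀ u : E, fderiv ℝ (fun z => fderiv ℝ f z u) x =
      (fderiv ℝ (fderiv ℝ f) x).flip u := by
    intro u
    have h := hd.hasFDerivAt.clm_apply (hasFDerivAt_const u x)
    rw [h.fderiv]
    ext z
    simp
  rw [key, key]
  exact hc.isSymmSndFDerivAt (by
    rw [minSmoothness_of_isRCLikeNormedField]; exact WithTop.coe_le_coe.2 (le_top : (2 : ℕ∞) ≤ ⊤)) w v

theorem contDiffOn_matrix_det {n : Type*} [Fintype n] [DecidableEq n] {s : Set E}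
    {A : E → Matrix n n ℝ} (hA : ∀ i j, ContDiffOn ℝ ∞ (fun p => A p i j) s) :
    ContDiffOn ℝ ∞ (fun p => (A p).det) s := by
  simp only [Matrix.det_apply]
  exact ContDiffOn.sum fun σ _ => (contDiffOn_prod fun i _ => hA _ _).const_smul _

/-- Cramer's rule: an entry of the inverse is a cofactor over the determinant, and a cofactor is the
determinant of a matrix with one row made constant. -/
theorem contDiffOn_matrix_inv {n : Type*} [Fintype n] [DecidableEq n] {s : Set E}
    {A : E → Matrix n n ℝ} (hA : ∀ i j, ContDiffOn ℝ ∞ (fun p => A p i j) s)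
    (hdet : ∀ p ∈ s, (A p).det ≠ 0) (i j : n) :
    ContDiffOn ℝ ∞ (fun p => (A p)⁻¹ i j) s := by
  simp only [Matrix.inv_def, Matrix.smul_apply, Matrix.adjugate_apply, Ring.inverse_eq_inv',
    smul_eq_mul]
  refine ((contDiffOn_matrix_det hA).inv hdet).mul (contDiffOn_matrix_det fun k l => ?_)
  by_cases h : k = j
  · subst h
    simpa using contDiffOn_const
  · simpa [Matrix.updateRow_ne h] using hA k l

end General

/-! ### Rules for `pd` -/

section Base

variable {U : Set Coord} {f g : Coord → ℝ} {x : Coord}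

theorem contDiffOn_pd (hU : IsOpen U) (hf : ContDiffOn ℝ ∞ f U) (i : Fin 4) :
    ContDiffOn ℝ ∞ (pd i f) U :=
  contDiffOn_fderiv_apply hU hf _

theorem pd_comm (hU : IsOpen U) (hf : ContDiffOn ℝ ∞ f U) (hx : x ∈ U) (i j : Fin 4) :
    pd i (pd j f) x = pd j (pd i f) x :=
  fderiv_fderiv_apply_comm hU hf hx _ _

theorem pd_congr (hU : IsOpen U) (h : ∀ z ∈ U, f z = g z) (hx : x ∈ U) (i : Fin 4) :
    pd i f x = pd i g x := by
  have : f =ᶠ[nhds x] g := Filter.eventually_of_mem (hU.mem_nhds hx) h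
  simp only [pd, this.fderiv_eq]

theorem _root_.ContDiffOn.differentiableAt_of_isOpen {E : Type*} [NormedAddCommGroup E]
    [NormedSpace ℝ E] {s : Set E} {f : E → ℝ} (hf : ContDiffOn ℝ ∞ f s) (hs : IsOpen s) {x : E}
    (hx : x ∈ s) : DifferentiableAt ℝ f x :=
  (hf.contDiffAt (hs.mem_nhds hx)).differentiableAt (by simp)

theorem pd_mul (hf : DifferentiableAt ℝ f x) (hg : DifferentiableAt ℝ g x) (i : Fin 4) :
    pd i (fun z => f z * g z) x = pd i f x * g x + f x * pd i g x := by
  simp only [pd, fderiv_fun_mul hf hg]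
  simp
  ring

theorem pd_add (hf : DifferentiableAt ℝ f x) (hg : DifferentiableAt ℝ g x) (i : Fin 4) :
    pd i (fun z => f z + g z) x = pd i f x + pd i g x := by
  simp only [pd, fderiv_fun_add hf hg]
  simp

theorem pd_sub (hf : DifferentiableAt ℝ f x) (hg : DifferentiableAt ℝ g x) (i : Fin 4) :
    pd i (fun z => f z - g z) x = pd i f x - pd i g x := by
  simp only [pd, fderiv_fun_sub hf hg]
  simp

theorem pd_neg (i : Fin 4) : pd i (fun z => - f z) x = - pd i f x := by
  simp only [pd, fderiv_fun_neg]
  simp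

theorem pd_const (c : ℝ) (i : Fin 4) : pd i (fun _ => c) x = 0 := by
  simp [pd]

theorem pd_sum {ι : Type*} {s : Finset ι} {f : ι → Coord → ℝ}
    (hf : ∀ k ∈ s, DifferentiableAt ℝ (f k) x) (i : Fin 4) :
    pd i (fun z => ∑ k ∈ s, f k z) x = ∑ k ∈ s, pd i (f k) x := by
  simp only [pd, fderiv_fun_sum hf]
  simp

theorem pd_const_mul (hf : DifferentiableAt ℝ f x) (c : ℝ) (i : Fin 4) :
    pd i (fun z => c * f z) x = c * pd i f x := by
  rw [pd_mul (differentiableAt_const c) hf, pd_const, zero_mul, zero_add]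

theorem pd_sum_mul {ι : Type*} {s : Finset ι} {f g : ι → Coord → ℝ}
    (hf : ∀ k ∈ s, DifferentiableAt ℝ (f k) x) (hg : ∀ k ∈ s, DifferentiableAt ℝ (g k) x)
    (i : Fin 4) : pd i (fun z => ∑ k ∈ s, f k z * g k z) x =
      ∑ k ∈ s, (pd i (f k) x * g k x + f k x * pd i (g k) x) := by
  rw [pd_sum (f := fun k z => f k z * g k z) fun k hk => (hf k hk).mul (hg k hk)]
  exact Finset.sum_congr rfl fun k hk => pd_mul (hf k hk) (hg k hk) i

end Base

/-! ### Rules for `dx` and `dy` -/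

/-- Smoothness on `D` of a function of `(x, y)`. -/
def SmoothOn (D : Set (Coord × Coord)) (f : Coord → Coord → ℝ) : Prop :=
  ContDiffOn ℝ ∞ (fun p : Coord × Coord => f p.1 p.2) D

section Bundle

variable {D : Set (Coord × Coord)} {f g : Coord → Coord → ℝ} {x y : Coord}

theorem SmoothOn.add (hf : SmoothOn D f) (hg : SmoothOn D g) :
    SmoothOn D (fun x y => f x y + g x y) := ContDiffOn.add hf hg

theorem SmoothOn.sub (hf : SmoothOn D f) (hg : SmoothOn D g) :
    SmoothOn D (fun x y => f x y - g x y) := ContDiffOn.sub hf hg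

theorem SmoothOn.mul (hf : SmoothOn D f) (hg : SmoothOn D g) :
    SmoothOn D (fun x y => f x y * g x y) := ContDiffOn.mul hf hg

theorem SmoothOn.pow (hf : SmoothOn D f) (n : ℕ) :
    SmoothOn D (fun x y => f x y ^ n) := ContDiffOn.pow hf n

theorem SmoothOn.sum {ι : Type*} {s : Finset ι} {f : ι → Coord → Coord → ℝ}
    (hf : ∀ k ∈ s, SmoothOn D (f k)) : SmoothOn D (fun x y => ∑ k ∈ s, f k x y) :=
  ContDiffOn.sum hf

theorem SmoothOn.const (c : ℝ) : SmoothOn D (fun _ _ => c) := contDiffOn_const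

theorem SmoothOn.fiberCoord (i : Fin 4) : SmoothOn D (fun _ y => y i) :=
  ((EuclideanSpace.proj i : Coord →L[ℝ] ℝ).contDiff.comp contDiff_snd).contDiffOn

theorem SmoothOn.of_base {U : Set Coord} {f : Coord → ℝ} (hf : ContDiffOn ℝ ∞ f U)
    (hD : ∀ p ∈ D, p.1 ∈ U) : SmoothOn D (fun x _ => f x) :=
  hf.comp contDiffOn_fst hD

theorem SmoothOn.congr (hf : SmoothOn D f) (h : ∀ x y, (x, y) ∈ D → g x y = f x y) :
    SmoothOn D g :=
  ContDiffOn.congr hf fun p hp => h p.1 p.2 hp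

theorem SmoothOn.hasFDerivAt (hf : SmoothOn D f) (hD : IsOpen D) (h : (x, y) ∈ D) :
    HasFDerivAt (fun p : Coord × Coord => f p.1 p.2)
      (fderiv ℝ (fun p : Coord × Coord => f p.1 p.2) (x, y)) (x, y) :=
  (ContDiffOn.differentiableAt_of_isOpen hf hD h).hasFDerivAt

theorem SmoothOn.hasFDerivAt_left (hf : SmoothOn D f) (hD : IsOpen D) (h : (x, y) ∈ D) :
    HasFDerivAt (fun z => f z y) ((fderiv ℝ (fun p : Coord × Coord => f p.1 p.2) (x, y)).comp
      (ContinuousLinearMap.inl ℝ Coord Coord)) x :=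
  HasFDerivAt.comp (f := fun z => (z, y)) x (hf.hasFDerivAt hD h)
    (hasFDerivAt_prodMk_left x y)

theorem SmoothOn.hasFDerivAt_right (hf : SmoothOn D f) (hD : IsOpen D) (h : (x, y) ∈ D) :
    HasFDerivAt (f x) ((fderiv ℝ (fun p : Coord × Coord => f p.1 p.2) (x, y)).comp
      (ContinuousLinearMap.inr ℝ Coord Coord)) y :=
  HasFDerivAt.comp (f := fun z => (x, z)) y (hf.hasFDerivAt hD h)
    (hasFDerivAt_prodMk_right x y)

/-- Turns a partial derivative into a directional derivative on the product, where smoothness and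
the symmetry of second derivatives are available. -/
theorem SmoothOn.dx_eq (hf : SmoothOn D f) (hD : IsOpen D) (h : (x, y) ∈ D) (i : Fin 4) :
    dx i f x y = fderiv ℝ (fun p : Coord × Coord => f p.1 p.2) (x, y)
      (EuclideanSpace.single i 1, 0) := by
  rw [dx, (hf.hasFDerivAt_left hD h).fderiv]
  rfl

theorem SmoothOn.dy_eq (hf : SmoothOn D f) (hD : IsOpen D) (h : (x, y) ∈ D) (i : Fin 4) :
    dy i f x y = fderiv ℝ (fun p : Coord × Coord => f p.1 p.2) (x, y)
      (0, EuclideanSpace.single i 1) := by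
  rw [dy, (hf.hasFDerivAt_right hD h).fderiv]
  rfl

theorem SmoothOn.dx (hf : SmoothOn D f) (hD : IsOpen D) (i : Fin 4) : SmoothOn D (dx i f) :=
  (contDiffOn_fderiv_apply hD hf _).congr fun _ hp => hf.dx_eq hD hp i

theorem SmoothOn.dy (hf : SmoothOn D f) (hD : IsOpen D) (i : Fin 4) : SmoothOn D (dy i f) :=
  (contDiffOn_fderiv_apply hD hf _).congr fun _ hp => hf.dy_eq hD hp i

theorem dx_congr (hD : IsOpen D) (h : ∀ x y, (x, y) ∈ D → f x y = g x y) (hxy : (x, y) ∈ D)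
    (i : Fin 4) : dx i f x y = dx i g x y := by
  have : (fun z => f z y) =ᶠ[nhds x] fun z => g z y := by
    have hc : Continuous fun z : Coord => (z, y) := by fun_prop
    filter_upwards [(hD.preimage hc).mem_nhds hxy] with z hz using h z y hz
  simp only [RandersSpacetime.dx, this.fderiv_eq]

theorem dy_congr (hD : IsOpen D) (h : ∀ x y, (x, y) ∈ D → f x y = g x y) (hxy : (x, y) ∈ D)
    (i : Fin 4) : dy i f x y = dy i g x y := by
  have : f x =ᶠ[nhds y] g x := by
    have hc : Continuous fun z : Coord => (x, z) := by fun_prop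
    filter_upwards [(hD.preimage hc).mem_nhds hxy] with z hz using h x z hz
  simp only [RandersSpacetime.dy, this.fderiv_eq]

theorem SmoothOn.dy_dx_comm (hf : SmoothOn D f) (hD : IsOpen D) (h : (x, y) ∈ D) (i j : Fin 4) :
    RandersSpacetime.dy i (RandersSpacetime.dx j f) x y =
      RandersSpacetime.dx j (RandersSpacetime.dy i f) x y := by
  rw [(hf.dx hD j).dy_eq hD h, (hf.dy hD i).dx_eq hD h]
  have e1 : (fun p : Coord × Coord => RandersSpacetime.dx j f p.1 p.2) =ᶠ[nhds (x, y)]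
      fun p => fderiv ℝ (fun p : Coord × Coord => f p.1 p.2) p (EuclideanSpace.single j 1, 0) := by
    filter_upwards [hD.mem_nhds h] with p hp using hf.dx_eq hD hp j
  have e2 : (fun p : Coord × Coord => RandersSpacetime.dy i f p.1 p.2) =ᶠ[nhds (x, y)]
      fun p => fderiv ℝ (fun p : Coord × Coord => f p.1 p.2) p (0, EuclideanSpace.single i 1) := by
    filter_upwards [hD.mem_nhds h] with p hp using hf.dy_eq hD hp i
  rw [e1.fderiv_eq, e2.fderiv_eq]
  exact fderiv_fderiv_apply_comm hD hf h _ _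

theorem SmoothOn.dy_dy_comm (hf : SmoothOn D f) (hD : IsOpen D) (h : (x, y) ∈ D) (i j : Fin 4) :
    RandersSpacetime.dy i (RandersSpacetime.dy j f) x y =
      RandersSpacetime.dy j (RandersSpacetime.dy i f) x y := by
  rw [(hf.dy hD j).dy_eq hD h, (hf.dy hD i).dy_eq hD h]
  have e : ∀ k, (fun p : Coord × Coord => RandersSpacetime.dy k f p.1 p.2) =ᶠ[nhds (x, y)]
      fun p => fderiv ℝ (fun p : Coord × Coord => f p.1 p.2) p (0, EuclideanSpace.single k 1) := by
    intro k
    filter_upwards [hD.mem_nhds h] with p hp using hf.dy_eq hD hp k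
  rw [(e i).fderiv_eq, (e j).fderiv_eq]
  exact fderiv_fderiv_apply_comm hD hf h _ _

section Rules

variable (hD : IsOpen D) (h : (x, y) ∈ D) (hf : SmoothOn D f) (hg : SmoothOn D g) (i : Fin 4)
include hD h hf hg

theorem dx_add : dx i (fun x y => f x y + g x y) x y = dx i f x y + dx i g x y :=
  pd_add (hf.hasFDerivAt_left hD h).differentiableAt (hg.hasFDerivAt_left hD h).differentiableAt i

theorem dx_mul : dx i (fun x y => f x y * g x y) x y =
    dx i f x y * g x y + f x y * dx i g x y :=
  pd_mul (hf.hasFDerivAt_left hD h).differentiableAt (hg.hasFDerivAt_left hD h).differentiableAt i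

theorem dy_add : dy i (fun x y => f x y + g x y) x y = dy i f x y + dy i g x y :=
  pd_add (hf.hasFDerivAt_right hD h).differentiableAt
    (hg.hasFDerivAt_right hD h).differentiableAt i

theorem dy_sub : dy i (fun x y => f x y - g x y) x y = dy i f x y - dy i g x y :=
  pd_sub (hf.hasFDerivAt_right hD h).differentiableAt
    (hg.hasFDerivAt_right hD h).differentiableAt i

theorem dy_mul : dy i (fun x y => f x y * g x y) x y =
    dy i f x y * g x y + f x y * dy i g x y :=
  pd_mul (hf.hasFDerivAt_right hD h).differentiableAt
    (hg.hasFDerivAt_right hD h).differentiableAt i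

end Rules

theorem dx_sum {ι : Type*} {s : Finset ι} {f : ι → Coord → Coord → ℝ} (hD : IsOpen D)
    (h : (x, y) ∈ D) (hf : ∀ k ∈ s, SmoothOn D (f k)) (i : Fin 4) :
    dx i (fun x y => ∑ k ∈ s, f k x y) x y = ∑ k ∈ s, dx i (f k) x y :=
  pd_sum (fun k hk => ((hf k hk).hasFDerivAt_left hD h).differentiableAt) i

theorem dy_sum {ι : Type*} {s : Finset ι} {f : ι → Coord → Coord → ℝ} (hD : IsOpen D)
    (h : (x, y) ∈ D) (hf : ∀ k ∈ s, SmoothOn D (f k)) (i : Fin 4) :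
    dy i (fun x y => ∑ k ∈ s, f k x y) x y = ∑ k ∈ s, dy i (f k) x y :=
  pd_sum (fun k hk => ((hf k hk).hasFDerivAt_right hD h).differentiableAt) i

theorem dy_base (f : Coord → ℝ) (i : Fin 4) : dy i (fun x _ => f x) x y = 0 :=
  pd_const (f x) i

theorem dx_fiber (f : Coord → ℝ) (i : Fin 4) : dx i (fun _ y => f y) x y = 0 :=
  pd_const (f y) i

theorem dx_base (f : Coord → ℝ) (i : Fin 4) : dx i (fun x _ => f x) x y = pd i f x := rfl

theorem dy_fiberCoord (i j : Fin 4) : dy i (fun _ y => y j) x y = if j = i then 1 else 0 := by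
  have : HasFDerivAt (fun y : Coord => y j) (EuclideanSpace.proj j : Coord →L[ℝ] ℝ) y :=
    (EuclideanSpace.proj j : Coord →L[ℝ] ℝ).hasFDerivAt
  rw [dy, this.fderiv]
  simp

end Bundle

/-! ### Algebra of the fundamental tensor of a Randers metric -/

open Matrix in
/-- The inverse of `s (a - u uᵀ) + (u + b) (u + b)ᵀ`, where `u = a n` and `b = a c`. -/
theorem randers_mul_inv {n : Type*} [Fintype n] [DecidableEq n] {a : Matrix n n ℝ}
    (ha : aᵀ = a) (hdet : IsUnit a.det) {v c : n → ℝ} {s : ℝ} (hs : s ≠ 0)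
    (hv : v ⬝ᵥ a *ᵥ v = 1) (hc : v ⬝ᵥ a *ᵥ c = s - 1) :
    (s • (a - vecMulVec (a *ᵥ v) (a *ᵥ v)) + vecMulVec (a *ᵥ v + a *ᵥ c) (a *ᵥ v + a *ᵥ c)) *
      (s⁻¹ • a⁻¹ + ((c ⬝ᵥ a *ᵥ c + s - 1) / s ^ 3) • vecMulVec v v -
        (s ^ 2)⁻¹ • (vecMulVec v c + vecMulVec c v)) = 1 := by
  have hinv : ∀ w : n → ℝ, (a *ᵥ w) ᵥ* a⁻¹ = w := by
    intro w
    rw [← vecMul_transpose, ha, vecMul_vecMul, mul_nonsing_inv _ hdet, vecMul_one]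
  have hc' : c ⬝ᵥ a *ᵥ v = s - 1 := by
    rw [← hc, dotProduct_mulVec, ← mulVec_transpose, ha, dotProduct_comm]
  have hv' : a *ᵥ v ⬝ᵥ v = 1 := by rw [dotProduct_comm, hv]
  have h1 : a *ᵥ v ⬝ᵥ c = s - 1 := by rw [dotProduct_comm, hc']
  have h2 : a *ᵥ c ⬝ᵥ v = s - 1 := by rw [dotProduct_comm, hc]
  have h3 : a *ᵥ c ⬝ᵥ c = c ⬝ᵥ a *ᵥ c := dotProduct_comm _ _
  simp only [add_mul, mul_add, mul_sub, sub_mul, smul_mul_assoc, mul_smul_comm, smul_sub, smul_add,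
    mul_nonsing_inv _ hdet, mul_vecMulVec, vecMulVec_mul, vecMulVec_mulVec, hinv,
    add_vecMulVec, vecMulVec_add, hv', h1, h2, h3]
  ext i j
  simp only [Matrix.add_apply, Matrix.sub_apply, Matrix.smul_apply, vecMulVec_apply, smul_eq_mul,
    Pi.smul_apply, MulOpposite.smul_eq_mul_unop, MulOpposite.unop_op]
  field_simp
  ring

/-- Each of the two sign conventions has a negative diagonal entry. -/
theorem IsLorentzian.exists_neg {g : Matrix (Fin 4) (Fin 4) ℝ} (hg : IsLorentzian g) :
    ∃ v : Fin 4 → ℝ, v ⬝ᵥ g *ᵥ v < 0 := by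
  obtain ⟨P, -, h⟩ := hg
  have key : ∀ w : Fin 4 → ℝ, (P *ᵥ w) ⬝ᵥ g *ᵥ (P *ᵥ w) = w ⬝ᵥ (Pᵀ * g * P) *ᵥ w := by
    intro w
    rw [Matrix.mulVec_mulVec, Matrix.mul_assoc, ← Matrix.mulVec_mulVec _ Pᵀ,
      Matrix.dotProduct_mulVec w, Matrix.vecMul_transpose]
  rcases h with h | h
  · exact ⟨P *ᵥ ![0, 1, 0, 0], by rw [key, h]; simp [Matrix.mulVec_diagonal, dotProduct,
      Fin.sum_univ_four]⟩
  · exact ⟨P *ᵥ ![1, 0, 0, 0], by rw [key, h]; simp [Matrix.mulVec_diagonal, dotProduct,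
      Fin.sum_univ_four]⟩

theorem IsLorentzian.det_ne_zero {g : Matrix (Fin 4) (Fin 4) ℝ} (hg : IsLorentzian g) :
    g.det ≠ 0 := by
  obtain ⟨P, -, h⟩ := hg
  intro h0
  have h1 : (Pᵀ * g * P).det = 0 := by simp [h0]
  rcases h with h | h <;> rw [h] at h1 <;> simp [Fin.prod_univ_four] at h1

open Matrix in
/-- If `s (a - u uᵀ) + w wᵀ` with `s > 0`, `u = a n` and `a(n, n) = 1` takes a negative value,
then so does `a`. -/
theorem exists_neg_of_randers {n : Type*} [Fintype n] {a : Matrix n n ℝ} (ha : aᵀ = a)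
    {u w z : n → ℝ} {s : ℝ} (hs : 0 < s) (hu : u ⬝ᵥ a *ᵥ u = 1)
    (hz : z ⬝ᵥ (s • (a - vecMulVec (a *ᵥ u) (a *ᵥ u)) + vecMulVec w w) *ᵥ z < 0) :
    ∃ v : n → ℝ, v ⬝ᵥ a *ᵥ v < 0 := by
  have hsym : u ⬝ᵥ a *ᵥ z = z ⬝ᵥ a *ᵥ u := by
    rw [dotProduct_mulVec, ← mulVec_transpose, ha, dotProduct_comm]
  -- The witness is the part of `z` that is `a`-orthogonal to `u`; there `a` equals `a(z,z) -
  -- a(z,u)²`, the only term of the given form that can be negative.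
  refine ⟨z - (z ⬝ᵥ a *ᵥ u) • u, ?_⟩
  have e1 : (z - (z ⬝ᵥ a *ᵥ u) • u) ⬝ᵥ a *ᵥ (z - (z ⬝ᵥ a *ᵥ u) • u) =
      z ⬝ᵥ a *ᵥ z - (z ⬝ᵥ a *ᵥ u) ^ 2 := by
    simp only [mulVec_sub, mulVec_smul, sub_dotProduct, dotProduct_sub, smul_dotProduct,
      dotProduct_smul, hu, hsym, smul_eq_mul]
    ring
  have e2 : z ⬝ᵥ (s • (a - vecMulVec (a *ᵥ u) (a *ᵥ u)) + vecMulVec w w) *ᵥ z =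
      s * (z ⬝ᵥ a *ᵥ z - (z ⬝ᵥ a *ᵥ u) ^ 2) + (z ⬝ᵥ w) ^ 2 := by
    simp only [add_mulVec, smul_mulVec, sub_mulVec, vecMulVec_mulVec, dotProduct_add,
      dotProduct_smul, dotProduct_sub, smul_eq_mul,
      op_smul_eq_smul, dotProduct_comm (a *ᵥ u) z, dotProduct_comm w z]
    ring
  rw [e1]
  rw [e2] at hz
  by_contra hcon
  nlinarith [mul_nonneg hs.le (not_lt.mp hcon), sq_nonneg (z ⬝ᵥ w)]

/-! ### Irrationality of the square root of an indefinite quadratic form -/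

theorem eq_zero_of_eventually_eq_zero {E : Type*} [NormedAddCommGroup E] [NormedSpace ℝ E]
    {p : E → ℝ} (hp : ∀ z, AnalyticAt ℝ p z) {y : E} (h : ∀ᶠ z in nhds y, p z = 0) (z : E) :
    p z = 0 :=
  congrFun (AnalyticOnNhd.eq_of_eventuallyEq (f := p) (g := 0) (fun z _ => hp z)
    (fun _ _ => analyticAt_const) (z₀ := y) h) z

/-- Squaring removes the root, and `q p₁² = p₂²` spreads to all of `E` by the identity theorem.
Where `q < 0` the two sides have opposite signs, so `p₁` and `p₂` vanish near `v`, hence everywhere.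
-/
theorem eq_zero_of_sqrt_mul_eq {E : Type*} [NormedAddCommGroup E] [NormedSpace ℝ E]
    {q p₁ p₂ : E → ℝ} (hq : ∀ z, AnalyticAt ℝ q z) (h₁ : ∀ z, AnalyticAt ℝ p₁ z)
    (h₂ : ∀ z, AnalyticAt ℝ p₂ z) {y v : E} (hv : q v < 0)
    (h : ∀ᶠ z in nhds y, 0 < q z ∧ √(q z) * p₁ z = p₂ z) (z : E) : p₁ z = 0 ∧ p₂ z = 0 := by
  have key : ∀ z, q z * p₁ z ^ 2 - p₂ z ^ 2 = 0 := by
    refine eq_zero_of_eventually_eq_zero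
      (fun z => ((hq z).mul ((h₁ z).pow 2)).sub ((h₂ z).pow 2)) (y := y) ?_
    filter_upwards [h] with z hz
    rw [← hz.2, mul_pow, Real.sq_sqrt hz.1.le, sub_self]
  have hneg : ∀ᶠ z in nhds v, p₁ z = 0 ∧ p₂ z = 0 := by
    filter_upwards [(hq v).continuousAt.eventually_lt_const hv] with z hz
    have hk := key z
    have h1 : p₁ z ^ 2 = 0 := by nlinarith [sq_nonneg (p₁ z), sq_nonneg (p₂ z)]
    have h2 : p₂ z ^ 2 = 0 := by nlinarith [sq_nonneg (p₁ z), sq_nonneg (p₂ z)]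
    exact ⟨pow_eq_zero_iff two_ne_zero |>.1 h1, pow_eq_zero_iff two_ne_zero |>.1 h2⟩
  exact ⟨eq_zero_of_eventually_eq_zero h₁ (hneg.mono fun _ h => h.1) z,
    eq_zero_of_eventually_eq_zero h₂ (hneg.mono fun _ h => h.2) z⟩

theorem analyticAt_coord (i : Fin 4) (z : Coord) : AnalyticAt ℝ (fun y : Coord => y i) z :=
  (EuclideanSpace.proj i : Coord →L[ℝ] ℝ).analyticAt z

theorem analyticAt_linear (b : Fin 4 → ℝ) (z : Coord) :
    AnalyticAt ℝ (fun y : Coord => ∑ i, b i * y i) z :=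
  Finset.analyticAt_fun_sum _ fun i _ => analyticAt_const.mul (analyticAt_coord i z)

theorem analyticAt_quadratic (a : Fin 4 → Fin 4 → ℝ) (z : Coord) :
    AnalyticAt ℝ (fun y : Coord => ∑ i, ∑ j, a i j * y i * y j) z :=
  Finset.analyticAt_fun_sum _ fun i _ => Finset.analyticAt_fun_sum _ fun j _ =>
    (analyticAt_const.mul (analyticAt_coord i z)).mul (analyticAt_coord j z)

theorem linear_eq_zero {b : Fin 4 → ℝ} (h : ∀ y : Coord, ∑ i, b i * y i = 0) (i : Fin 4) :
    b i = 0 := by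
  simpa using h (EuclideanSpace.single i 1)

theorem quadratic_eq_zero {a : Fin 4 → Fin 4 → ℝ}
    (h : ∀ y : Coord, ∑ i, ∑ j, a i j * y i * y j = 0) (i j : Fin 4) : a i j + a j i = 0 := by
  have hd : ∀ i, a i i = 0 := fun i => by simpa using h (EuclideanSpace.single i 1)
  have := h (EuclideanSpace.single i 1 + EuclideanSpace.single j 1)
  simp [mul_add, Finset.sum_add_distrib, hd] at this
  linarith

/-! ### The Levi-Civita connection in local coordinates -/

/-- `a` is the component matrix of a smooth pseudo-Riemannian metric on the open set `U`. -/
structure IsMetricOn (U : Set Coord) (a : Coord → Matrix (Fin 4) (Fin 4) ℝ) : Prop where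
  isOpen : IsOpen U
  contDiffOn : ∀ i j, ContDiffOn ℝ ∞ (fun x => a x i j) U
  symm : ∀ x ∈ U, ∀ i j, a x i j = a x j i
  det_ne_zero : ∀ x ∈ U, (a x).det ≠ 0

namespace IsMetricOn

variable {U : Set Coord} {a : Coord → Matrix (Fin 4) (Fin 4) ℝ} {x : Coord}

theorem transpose_eq (h : IsMetricOn U a) (hx : x ∈ U) : (a x)ᵀ = a x := by
  ext i j
  exact h.symm x hx j i

theorem isUnit_det (h : IsMetricOn U a) (hx : x ∈ U) : IsUnit (a x).det :=
  isUnit_iff_ne_zero.2 (h.det_ne_zero x hx)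

theorem inv_symm (h : IsMetricOn U a) (hx : x ∈ U) (i j : Fin 4) :
    (a x)⁻¹ i j = (a x)⁻¹ j i := by
  have := Matrix.transpose_nonsing_inv (a x)
  rw [h.transpose_eq hx] at this
  exact (congrFun (congrFun this j) i)

theorem pd_symm (h : IsMetricOn U a) (hx : x ∈ U) (l i j : Fin 4) :
    pd l (fun x => a x i j) x = pd l (fun x => a x j i) x :=
  pd_congr h.isOpen (fun z hz => h.symm z hz i j) hx l

theorem christoffel_symm (h : IsMetricOn U a) (hx : x ∈ U) (i j k : Fin 4) :
    christoffel a i j k x = christoffel a i k j x := by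
  simp only [christoffel]
  congr 1
  refine Finset.sum_congr rfl fun l _ => ?_
  rw [h.pd_symm hx l j k, add_comm (pd j _ x)]

theorem contDiffOn_inv (h : IsMetricOn U a) (i j : Fin 4) :
    ContDiffOn ℝ ∞ (fun x => (a x)⁻¹ i j) U :=
  contDiffOn_matrix_inv h.contDiffOn h.det_ne_zero i j

theorem contDiffOn_christoffel (h : IsMetricOn U a) (i j k : Fin 4) :
    ContDiffOn ℝ ∞ (christoffel a i j k) U := by
  have hp : ∀ l i j, ContDiffOn ℝ ∞ (pd l fun x => a x i j) U :=
    fun l i j => contDiffOn_pd h.isOpen (h.contDiffOn i j) l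
  exact contDiffOn_const.mul (ContDiffOn.sum fun l _ =>
    (h.contDiffOn_inv i l).mul (((hp j l k).add (hp k l j)).sub (hp l j k)))

theorem sum_inv_mul (h : IsMetricOn U a) (hx : x ∈ U) (i j : Fin 4) :
    ∑ k, (a x)⁻¹ i k * a x k j = if i = j then 1 else 0 := by
  have := congrFun (congrFun (Matrix.nonsing_inv_mul (a x) (h.isUnit_det hx)) i) j
  rwa [Matrix.mul_apply, Matrix.one_apply] at this

theorem sum_mul_inv (h : IsMetricOn U a) (hx : x ∈ U) (i j : Fin 4) :
    ∑ k, a x i k * (a x)⁻¹ k j = if i = j then 1 else 0 := by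
  have := congrFun (congrFun (Matrix.mul_nonsing_inv (a x) (h.isUnit_det hx)) i) j
  rwa [Matrix.mul_apply, Matrix.one_apply] at this

theorem sum_mul_christoffel (h : IsMetricOn U a) (hx : x ∈ U) (i j k : Fin 4) :
    ∑ m, a x i m * christoffel a m j k x =
      (1 / 2) * (pd j (fun x => a x i k) x + pd k (fun x => a x i j) x -
        pd i (fun x => a x j k) x) := by
  have e : ∀ m, a x i m * christoffel a m j k x = ∑ l, (a x i m * (a x)⁻¹ m l) * ((1 / 2) *
      (pd j (fun x => a x l k) x + pd k (fun x => a x l j) x - pd l (fun x => a x j k) x)) := by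
    intro m
    rw [christoffel, Finset.mul_sum, Finset.mul_sum]
    exact Finset.sum_congr rfl fun l _ => by ring
  simp only [e]
  rw [Finset.sum_comm]
  simp only [← Finset.sum_mul, h.sum_mul_inv hx, ite_mul, one_mul, zero_mul, Finset.sum_ite_eq,
    Finset.mem_univ, if_true]

/-- The Levi-Civita connection is metric. -/
theorem pd_eq (h : IsMetricOn U a) (hx : x ∈ U) (i j k : Fin 4) :
    pd i (fun x => a x j k) x =
      ∑ m, a x j m * christoffel a m i k x + ∑ m, a x k m * christoffel a m i j x := by
  rw [h.sum_mul_christoffel hx, h.sum_mul_christoffel hx, h.pd_symm hx i k j,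
    h.pd_symm hx j i k, h.pd_symm hx k i j]
  ring

/-- The Levi-Civita connection is the only symmetric metric connection. -/
theorem christoffel_eq (h : IsMetricOn U a) (hx : x ∈ U) {Γ : Fin 4 → Fin 4 → Fin 4 → ℝ}
    (hΓ : ∀ i j k, Γ i j k = Γ i k j)
    (hm : ∀ i j k, pd i (fun x => a x j k) x = ∑ m, a x j m * Γ m i k + ∑ m, a x k m * Γ m i j)
    (i j k : Fin 4) : christoffel a i j k x = Γ i j k := by
  -- The Koszul combination: symmetry of `Γ` cancels all terms but one pair.
  have key : ∀ l, pd j (fun x => a x l k) x + pd k (fun x => a x l j) x -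
      pd l (fun x => a x j k) x = 2 * ∑ m, a x l m * Γ m j k := by
    intro l
    rw [hm, hm, hm]
    simp only [hΓ _ k j, hΓ _ l j, hΓ _ l k]
    ring
  simp only [christoffel, key]
  have e : ∀ l, (a x)⁻¹ i l * (2 * ∑ m, a x l m * Γ m j k) =
      ∑ m, 2 * (((a x)⁻¹ i l * a x l m) * Γ m j k) := by
    intro l
    rw [Finset.mul_sum, Finset.mul_sum]
    exact Finset.sum_congr rfl fun m _ => by ring
  simp only [e]
  rw [Finset.sum_comm]
  simp only [← Finset.mul_sum, ← Finset.sum_mul, h.sum_inv_mul hx, ite_mul, one_mul, zero_mul,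
    Finset.sum_ite_eq, Finset.mem_univ, if_true]
  ring

/-- Differentiate `a⁻¹ a = 1`. -/
theorem pd_inv (h : IsMetricOn U a) (hx : x ∈ U) (k : Fin 4) :
    (Matrix.of fun i j => pd k (fun x => (a x)⁻¹ i j) x) =
      - ((a x)⁻¹ * (Matrix.of fun i j => pd k (fun x => a x i j) x) * (a x)⁻¹) := by
  have hd : ∀ i j, DifferentiableAt ℝ (fun x => a x i j) x :=
    fun i j => (h.contDiffOn i j).differentiableAt_of_isOpen h.isOpen hx
  have hd' : ∀ i j, DifferentiableAt ℝ (fun x => (a x)⁻¹ i j) x :=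
    fun i j => (h.contDiffOn_inv i j).differentiableAt_of_isOpen h.isOpen hx
  have key : (Matrix.of fun i j => pd k (fun x => (a x)⁻¹ i j) x) * a x +
      (a x)⁻¹ * (Matrix.of fun i j => pd k (fun x => a x i j) x) = 0 := by
    ext i j
    have e : pd k (fun x => ∑ m, (a x)⁻¹ i m * a x m j) x = 0 := by
      rw [pd_congr h.isOpen (fun z hz => h.sum_inv_mul hz i j) hx, pd_const]
    rw [pd_sum_mul (fun m _ => hd' i m) fun m _ => hd m j, Finset.sum_add_distrib] at e
    simpa [Matrix.mul_apply] using e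
  rw [← neg_mul, ← eq_neg_of_add_eq_zero_left key, Matrix.mul_assoc,
    Matrix.mul_nonsing_inv _ (h.isUnit_det hx), Matrix.mul_one]

theorem sum_christoffel_eq (h : IsMetricOn U a) (hx : x ∈ U) (l : Fin 4) :
    ∑ i, christoffel a i i l x =
      (1 / 2) * ∑ i, ∑ m, (a x)⁻¹ i m * pd l (fun x => a x m i) x := by
  simp only [christoffel, ← Finset.mul_sum, mul_add, mul_sub, Finset.sum_add_distrib,
    Finset.sum_sub_distrib]
  have e : ∑ i, ∑ m, (a x)⁻¹ i m * pd m (fun x => a x i l) x =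
      ∑ i, ∑ m, (a x)⁻¹ i m * pd i (fun x => a x m l) x := by
    rw [Finset.sum_comm]
    exact Finset.sum_congr rfl fun i _ => Finset.sum_congr rfl fun m _ => by
      rw [h.inv_symm hx]
  rw [e]
  ring

/-- The contraction `Γⁱᵢₗ` is the logarithmic derivative of `√|det a|`, hence a closed form. Here
closedness is read off from `Γⁱᵢₗ = ½ tr(a⁻¹ ∂ₗa)`: one term is symmetric by cyclicity of the trace,
the other because partial derivatives commute. -/
theorem pd_sum_christoffel_symm (h : IsMetricOn U a) (hx : x ∈ U) (k l : Fin 4) :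
    ∑ i, pd k (christoffel a i i l) x = ∑ i, pd l (christoffel a i i k) x := by
  have hd' : ∀ i j, DifferentiableAt ℝ (fun x => (a x)⁻¹ i j) x :=
    fun i j => (h.contDiffOn_inv i j).differentiableAt_of_isOpen h.isOpen hx
  have hp : ∀ l i j, DifferentiableAt ℝ (pd l fun x => a x i j) x := fun l i j =>
    (contDiffOn_pd h.isOpen (h.contDiffOn i j) l).differentiableAt_of_isOpen h.isOpen hx
  have key : ∀ k l, ∑ i, pd k (christoffel a i i l) x = (1 / 2) *
      (Matrix.trace (- ((a x)⁻¹ * (Matrix.of fun i j => pd k (fun x => a x i j) x) * (a x)⁻¹) *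
          (Matrix.of fun i j => pd l (fun x => a x i j) x)) +
        ∑ i, ∑ m, (a x)⁻¹ i m * pd k (pd l fun x => a x m i) x) := by
    intro k l
    rw [← pd_sum fun i _ =>
      (h.contDiffOn_christoffel i i l).differentiableAt_of_isOpen h.isOpen hx,
      pd_congr h.isOpen (fun z hz => h.sum_christoffel_eq hz l) hx,
      pd_const_mul (DifferentiableAt.fun_sum fun i _ => DifferentiableAt.fun_sum fun m _ =>
        (hd' i m).fun_mul (hp l m i)),
      pd_sum fun i _ => DifferentiableAt.fun_sum fun m _ => (hd' i m).fun_mul (hp l m i),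
      ← h.pd_inv hx k]
    congr 1
    simp only [Matrix.trace, Matrix.diag, Matrix.mul_apply, Matrix.of_apply,
      ← Finset.sum_add_distrib]
    refine Finset.sum_congr rfl fun i _ => ?_
    exact pd_sum_mul (fun m _ => hd' i m) (fun m _ => hp l m i) k
  rw [key, key]
  congr 2
  · rw [Matrix.neg_mul, Matrix.neg_mul, Matrix.trace_neg, Matrix.trace_neg, Matrix.mul_assoc,
      Matrix.trace_mul_comm]
    simp only [Matrix.mul_assoc]
  · exact Finset.sum_congr rfl fun i _ => Finset.sum_congr rfl fun m _ => by
      rw [pd_comm h.isOpen (h.contDiffOn m i) hx]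

/-- Only `∂ₖ Γⁱᵢₗ` is not visibly symmetric; closedness of `Γⁱᵢₗ` settles it. -/
theorem ricci_symm (h : IsMetricOn U a) (hx : x ∈ U) (l k : Fin 4) :
    ricci a l k x = ricci a k l x := by
  simp only [ricci, riemann, Finset.sum_add_distrib, Finset.sum_sub_distrib]
  rw [h.pd_sum_christoffel_symm hx k l]
  have e1 : ∀ i, pd i (christoffel a i k l) x = pd i (christoffel a i l k) x := fun i =>
    pd_congr h.isOpen (fun z hz => h.christoffel_symm hz i k l) hx i
  have e2 : ∑ i, ∑ m, christoffel a i m k x * christoffel a m i l x =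
      ∑ i, ∑ m, christoffel a i m l x * christoffel a m i k x := by
    rw [Finset.sum_comm]
    exact Finset.sum_congr rfl fun i _ => Finset.sum_congr rfl fun m _ => mul_comm _ _
  simp only [e1, e2, h.christoffel_symm hx _ k l]

end IsMetricOn

/-- The 1-form with components `b` is parallel on `U`. -/
def IsParallelOn (U : Set Coord) (a : Coord → Matrix (Fin 4) (Fin 4) ℝ)
    (b : Fin 4 → Coord → ℝ) : Prop :=
  ∀ x ∈ U, ∀ i j, pd i (b j) x - ∑ k, christoffel a k i j x * b k x = 0

/-! ### Parallel 1-forms and the Ricci identity. -/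

section Parallel

variable {U : Set Coord} {a : Coord → Matrix (Fin 4) (Fin 4) ℝ} {b : Fin 4 → Coord → ℝ} {x : Coord}

theorem IsMetricOn.mulVec_inv_mulVec (h : IsMetricOn U a) (hx : x ∈ U) (v : Fin 4 → ℝ) :
    a x *ᵥ ((a x)⁻¹ *ᵥ v) = v := by
  rw [Matrix.mulVec_mulVec, Matrix.mul_nonsing_inv _ (h.isUnit_det hx), Matrix.one_mulVec]

theorem IsMetricOn.contDiffOn_dual (h : IsMetricOn U a) (hbs : ∀ i, ContDiffOn ℝ ∞ (b i) U)
    (i : Fin 4) : ContDiffOn ℝ ∞ (fun x => ((a x)⁻¹ *ᵥ fun j => b j x) i) U := by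
  simp only [Matrix.mulVec, dotProduct]
  exact ContDiffOn.sum fun j _ => (h.contDiffOn_inv i j).mul (hbs j)

/-- The vector field dual to a parallel 1-form is parallel. -/
theorem IsParallelOn.pd_dual (hb : IsParallelOn U a b) (h : IsMetricOn U a)
    (hbs : ∀ i, ContDiffOn ℝ ∞ (b i) U) (hx : x ∈ U) (i k : Fin 4) :
    pd k (fun x => ((a x)⁻¹ *ᵥ fun j => b j x) i) x =
      - ∑ m, christoffel a i k m x * ((a x)⁻¹ *ᵥ fun j => b j x) m := by
  set c : Fin 4 → Coord → ℝ := fun i x => ((a x)⁻¹ *ᵥ fun j => b j x) i with hc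
  have hcs : ∀ i, ContDiffOn ℝ ∞ (c i) U := h.contDiffOn_dual hbs
  have hcd : ∀ i, DifferentiableAt ℝ (c i) x := fun i =>
    (hcs i).differentiableAt_of_isOpen h.isOpen hx
  have had : ∀ i j, DifferentiableAt ℝ (fun x => a x i j) x :=
    fun i j => (h.contDiffOn i j).differentiableAt_of_isOpen h.isOpen hx
  have hac : ∀ z ∈ U, ∀ i, ∑ j, a z i j * c j z = b i z := fun z hz i =>
    congrFun (h.mulVec_inv_mulVec hz fun j => b j z) i
  -- Differentiating `a c = b`, with `a` and `b` both parallel, leaves `a (∇c) = 0`; nondegeneracy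
  -- then removes `a`.
  have key : ∀ p, ∑ j, a x p j * (pd k (c j) x + ∑ m, christoffel a j k m x * c m x) = 0 := by
    intro p
    have e := pd_congr h.isOpen (fun z hz => hac z hz p) hx k
    rw [pd_sum_mul (fun j _ => had p j) fun j _ => hcd j, sub_eq_zero.1 (hb x hx k p)] at e
    simp only [h.pd_eq hx, Finset.sum_add_distrib, add_mul] at e
    have e1 : ∑ m, christoffel a m k p x * b m x =
        ∑ j, (∑ m, a x j m * christoffel a m k p x) * c j x := by
      simp only [← hac x hx, Finset.mul_sum, Finset.sum_mul]
      rw [Finset.sum_comm]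
      refine Finset.sum_congr rfl fun j _ => Finset.sum_congr rfl fun m _ => ?_
      rw [h.symm x hx m j]
      ring
    have e2 : ∑ j, a x p j * ∑ m, christoffel a j k m x * c m x =
        ∑ j, (∑ m, a x p m * christoffel a m k j x) * c j x := by
      simp only [Finset.mul_sum, Finset.sum_mul]
      rw [Finset.sum_comm]
      exact Finset.sum_congr rfl fun j _ => Finset.sum_congr rfl fun m _ => by ring
    simp only [mul_add, Finset.sum_add_distrib, e2]
    linarith
  have := Matrix.eq_zero_of_mulVec_eq_zero (h.det_ne_zero x hx)
    (v := fun j => pd k (c j) x + ∑ m, christoffel a j k m x * c m x) (funext key)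
  exact eq_neg_of_add_eq_zero_left (congrFun this i)

/-- The Ricci identity for a parallel vector field. -/
theorem IsMetricOn.sum_riemann_mul_eq_zero (h : IsMetricOn U a) {c : Fin 4 → Coord → ℝ}
    (hcs : ∀ i, ContDiffOn ℝ ∞ (c i) U)
    (hc : ∀ x ∈ U, ∀ i k, pd k (c i) x = - ∑ m, christoffel a i k m x * c m x)
    (hx : x ∈ U) (i j k : Fin 4) : ∑ l, riemann a l i j k x * c l x = 0 := by
  have hcd : ∀ i, DifferentiableAt ℝ (c i) x := fun i =>
    (hcs i).differentiableAt_of_isOpen h.isOpen hx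
  have hΓ : ∀ i j k, DifferentiableAt ℝ (christoffel a i j k) x := fun i j k =>
    (h.contDiffOn_christoffel i j k).differentiableAt_of_isOpen h.isOpen hx
  -- Parallelism differentiated once more; the part antisymmetric in `j, k` is, up to sign, the
  -- curvature applied to `c`, and it vanishes as partial derivatives commute.
  have key : ∀ j k, pd j (pd k (c i)) x = - ∑ l, (pd j (christoffel a i k l) x -
      ∑ m, christoffel a i k m x * christoffel a m j l x) * c l x := by
    intro j k
    rw [pd_congr h.isOpen (fun z hz => hc z hz i k) hx, pd_neg,
      pd_sum_mul (fun m _ => hΓ i k m) fun m _ => hcd m]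
    simp only [hc x hx, Finset.sum_add_distrib, sub_mul,
      Finset.sum_sub_distrib, mul_neg, Finset.sum_neg_distrib, Finset.mul_sum, Finset.sum_mul]
    rw [Finset.sum_comm (f := fun m l => christoffel a i k m x * (christoffel a m j l x * c l x))]
    simp only [mul_assoc]
    ring
  have e := pd_comm h.isOpen (hcs i) hx j k
  rw [key, key, neg_inj, ← sub_eq_zero, ← Finset.sum_sub_distrib] at e
  rw [← e]
  refine Finset.sum_congr rfl fun l _ => ?_
  rw [riemann, ← sub_mul, Finset.sum_sub_distrib]
  simp only [h.christoffel_symm hx i j, h.christoffel_symm hx i k]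
  ring

theorem IsParallelOn.sum_ricci_mul_dual (hb : IsParallelOn U a b) (h : IsMetricOn U a)
    (hbs : ∀ i, ContDiffOn ℝ ∞ (b i) U) (hx : x ∈ U) (k : Fin 4) :
    ∑ l, ricci a l k x * ((a x)⁻¹ *ᵥ fun j => b j x) l = 0 := by
  have e : ∀ i, _ := fun i => h.sum_riemann_mul_eq_zero
    (c := fun i x => ((a x)⁻¹ *ᵥ fun j => b j x) i)
    (h.contDiffOn_dual hbs) (fun z hz i k => hb.pd_dual h hbs hz i k) hx i i k
  simp only [ricci, Finset.sum_mul]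
  rw [Finset.sum_comm]
  exact Finset.sum_eq_zero fun i _ => e i

end Parallel

/-! ### Randers metrics in local coordinates -/

/-- The quadratic form `a_{ij}(x) yⁱ yʲ`. -/
noncomputable def quad (a : Coord → Matrix (Fin 4) (Fin 4) ℝ) (x y : Coord) : ℝ :=
  ∑ i, ∑ j, a x i j * y i * y j

/-- The linear form `bᵢ(x) yⁱ`. -/
noncomputable def lin (b : Fin 4 → Coord → ℝ) (x y : Coord) : ℝ :=
  ∑ i, b i x * y i

theorem dy_lin (b : Fin 4 → Coord → ℝ) (i : Fin 4) (x y : Coord) : dy i (lin b) x y = b i x := by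
  have h : dy i (lin b) x y = dy i (fun _ y => ∑ j, b j x * y j) x y := rfl
  rw [h, dy_sum isOpen_univ (Set.mem_univ _) fun j _ =>
    (SmoothOn.const (b j x)).mul (SmoothOn.fiberCoord j)]
  simp [dy_mul isOpen_univ (Set.mem_univ _) (SmoothOn.const (b _ x)) (SmoothOn.fiberCoord _),
    dy_base, dy_fiberCoord]

theorem dy_quad (a : Coord → Matrix (Fin 4) (Fin 4) ℝ) (k : Fin 4) (x y : Coord) :
    dy k (quad a) x y = ∑ j, (a x k j + a x j k) * y j := by
  have h : dy k (quad a) x y = dy k (fun _ y => ∑ i, ∑ j, a x i j * y i * y j) x y := rfl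
  have hs : ∀ i j, SmoothOn Set.univ fun _ y : Coord => a x i j * y i := fun i j =>
    (SmoothOn.const (a x i j)).mul (SmoothOn.fiberCoord i)
  rw [h, dy_sum isOpen_univ (Set.mem_univ _) fun i _ => SmoothOn.sum fun j _ =>
    (hs i j).mul (SmoothOn.fiberCoord j)]
  simp only [dy_sum isOpen_univ (Set.mem_univ _) fun j _ => (hs _ j).mul (SmoothOn.fiberCoord j),
    dy_mul isOpen_univ (Set.mem_univ _) (hs _ _) (SmoothOn.fiberCoord _),
    dy_mul isOpen_univ (Set.mem_univ _) (SmoothOn.const (a x _ _)) (SmoothOn.fiberCoord _),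
    dy_base, dy_fiberCoord, zero_mul, zero_add, mul_ite, mul_one, mul_zero, ite_mul,
    Finset.sum_add_distrib, Finset.sum_ite_eq', Finset.mem_univ, if_true, add_mul]
  congr 1
  rw [Finset.sum_comm]
  simp

/-- `f = √(a(y, y)) + b(y)` on the open set `D` is the coordinate expression of a Finsler spacetime
of Randers type, over the open set `U` of base points. -/
structure IsLocalRanders (U : Set Coord) (D : Set (Coord × Coord)) (f : Coord → Coord → ℝ)
    (a : Coord → Matrix (Fin 4) (Fin 4) ℝ) (b : Fin 4 → Coord → ℝ) : Prop where
  metric : IsMetricOn U a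
  contDiffOn_form : ∀ i, ContDiffOn ℝ ∞ (b i) U
  isOpen : IsOpen D
  fst_mem : ∀ p ∈ D, p.1 ∈ U
  fiber_nonempty : ∀ x ∈ U, ∃ y, (x, y) ∈ D
  quad_pos : ∀ x y, (x, y) ∈ D → 0 < quad a x y
  eq : ∀ x y, (x, y) ∈ D → f x y = √(quad a x y) + lin b x y
  nonneg : ∀ x y, (x, y) ∈ D → 0 ≤ f x y
  lorentzian : ∀ x y, (x, y) ∈ D → IsLorentzian (fundamentalTensor f x y)

namespace IsLocalRanders

variable {U : Set Coord} {D : Set (Coord × Coord)} {f : Coord → Coord → ℝ}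
  {a : Coord → Matrix (Fin 4) (Fin 4) ℝ} {b : Fin 4 → Coord → ℝ} {x y : Coord}

theorem smoothOn_metric (h : IsLocalRanders U D f a b) (i j : Fin 4) :
    SmoothOn D (fun x _ => a x i j) :=
  SmoothOn.of_base (h.metric.contDiffOn i j) h.fst_mem

theorem smoothOn_form (h : IsLocalRanders U D f a b) (i : Fin 4) : SmoothOn D (fun x _ => b i x) :=
  SmoothOn.of_base (h.contDiffOn_form i) h.fst_mem

theorem smoothOn_quad (h : IsLocalRanders U D f a b) : SmoothOn D (quad a) :=
  SmoothOn.sum fun i _ => SmoothOn.sum fun j _ =>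
    ((h.smoothOn_metric i j).mul (SmoothOn.fiberCoord i)).mul (SmoothOn.fiberCoord j)

theorem smoothOn_lin (h : IsLocalRanders U D f a b) : SmoothOn D (lin b) :=
  SmoothOn.sum fun i _ => (h.smoothOn_form i).mul (SmoothOn.fiberCoord i)

theorem smoothOn_sqrt (h : IsLocalRanders U D f a b) : SmoothOn D (fun x y => √(quad a x y)) :=
  ContDiffOn.sqrt h.smoothOn_quad fun p hp => (h.quad_pos p.1 p.2 hp).ne'

theorem smoothOn (h : IsLocalRanders U D f a b) : SmoothOn D f :=
  (h.smoothOn_sqrt.add h.smoothOn_lin).congr h.eq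

theorem sqrt_pos (h : IsLocalRanders U D f a b) (hxy : (x, y) ∈ D) : 0 < √(quad a x y) :=
  Real.sqrt_pos.2 (h.quad_pos x y hxy)

theorem sqrt_mul_self (h : IsLocalRanders U D f a b) (hxy : (x, y) ∈ D) :
    √(quad a x y) * √(quad a x y) = quad a x y :=
  Real.mul_self_sqrt (h.quad_pos x y hxy).le

theorem dx_quad (h : IsLocalRanders U D f a b) (hxy : (x, y) ∈ D) (l : Fin 4) :
    dx l (quad a) x y = ∑ i, ∑ j, pd l (fun x => a x i j) x * y i * y j := by
  have hs : ∀ i j, SmoothOn D fun x y : Coord => a x i j * y i := fun i j =>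
    (h.smoothOn_metric i j).mul (SmoothOn.fiberCoord i)
  have e : dx l (quad a) x y = dx l (fun x y => ∑ i, ∑ j, a x i j * y i * y j) x y := rfl
  rw [e, dx_sum h.isOpen hxy fun i _ => SmoothOn.sum fun j _ =>
    (hs i j).mul (SmoothOn.fiberCoord j)]
  simp only [dx_sum h.isOpen hxy fun j _ => (hs _ j).mul (SmoothOn.fiberCoord j),
    dx_mul h.isOpen hxy (hs _ _) (SmoothOn.fiberCoord _),
    dx_mul h.isOpen hxy (h.smoothOn_metric _ _) (SmoothOn.fiberCoord _), dx_base,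
    dx_fiber fun y : Coord => y _, mul_zero, add_zero]

theorem dx_lin (h : IsLocalRanders U D f a b) (hxy : (x, y) ∈ D) (l : Fin 4) :
    dx l (lin b) x y = ∑ i, pd l (b i) x * y i := by
  have e : dx l (lin b) x y = dx l (fun x y => ∑ i, b i x * y i) x y := rfl
  rw [e, dx_sum h.isOpen hxy fun i _ => (h.smoothOn_form i).mul (SmoothOn.fiberCoord i)]
  simp only [dx_mul h.isOpen hxy (h.smoothOn_form _) (SmoothOn.fiberCoord _),
    dx_fiber fun y : Coord => y _, mul_zero, add_zero]
  rfl

theorem dx_eq (h : IsLocalRanders U D f a b) (hxy : (x, y) ∈ D) (l : Fin 4) :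
    dx l f x y = (∑ i, ∑ j, pd l (fun x => a x i j) x * y i * y j) / (2 * √(quad a x y)) +
      ∑ i, pd l (b i) x * y i := by
  rw [dx_congr h.isOpen h.eq hxy, dx_add h.isOpen hxy h.smoothOn_sqrt h.smoothOn_lin,
    h.dx_lin hxy, ← h.dx_quad hxy]
  congr 1
  -- The derivative of `α` comes from the product rule on `α · α = a(y, y)`.
  have e := dx_congr h.isOpen (fun x y hxy => h.sqrt_mul_self hxy) hxy l
  rw [dx_mul h.isOpen hxy h.smoothOn_sqrt h.smoothOn_sqrt] at e
  have := (h.sqrt_pos hxy).ne'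
  field_simp
  linarith

/-- The derivatives `uᵢ = a_{ij} yʲ / α` of `α`. -/
theorem dy_sqrt (h : IsLocalRanders U D f a b) (hxy : (x, y) ∈ D) (i : Fin 4) :
    dy i (fun x y => √(quad a x y)) x y = (∑ j, a x i j * y j) / √(quad a x y) := by
  have e := dy_congr h.isOpen (fun x y hxy => h.sqrt_mul_self hxy) hxy i
  rw [dy_mul h.isOpen hxy h.smoothOn_sqrt h.smoothOn_sqrt, dy_quad] at e
  have e2 : ∑ j, (a x i j + a x j i) * y j = 2 * ∑ j, a x i j * y j := by
    rw [Finset.mul_sum]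
    refine Finset.sum_congr rfl fun j _ => ?_
    rw [h.metric.symm x (h.fst_mem _ hxy) j i]
    ring
  have := (h.sqrt_pos hxy).ne'
  field_simp
  linarith

theorem dy_eq (h : IsLocalRanders U D f a b) (hxy : (x, y) ∈ D) (i : Fin 4) :
    dy i f x y = (∑ j, a x i j * y j) / √(quad a x y) + b i x := by
  rw [dy_congr h.isOpen h.eq hxy, dy_add h.isOpen hxy h.smoothOn_sqrt h.smoothOn_lin, dy_lin,
    h.dy_sqrt hxy]

theorem dy_dy_eq (h : IsLocalRanders U D f a b) (hxy : (x, y) ∈ D) (i j : Fin 4) :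
    dy i (dy j f) x y = (a x i j - (∑ k, a x i k * y k) / √(quad a x y) *
      ((∑ k, a x j k * y k) / √(quad a x y))) / √(quad a x y) := by
  -- The first derivative is cleared of its denominator, so that the product rule gives the second.
  have e : ∀ x y, (x, y) ∈ D → √(quad a x y) * (dy j f x y - b j x) =
      lin (fun k x => a x j k) x y := by
    intro x y hxy
    have := (h.sqrt_pos hxy).ne'
    rw [h.dy_eq hxy, lin]
    field_simp
    ring
  have e' := dy_congr h.isOpen e hxy i
  rw [dy_mul h.isOpen hxy h.smoothOn_sqrt ((h.smoothOn.dy h.isOpen j).sub (h.smoothOn_form j)),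
    dy_sub h.isOpen hxy (h.smoothOn.dy h.isOpen j) (h.smoothOn_form j), dy_base, dy_lin,
    h.dy_sqrt hxy, h.dy_eq hxy j, h.metric.symm x (h.fst_mem _ hxy) j i] at e'
  rw [eq_div_iff (h.sqrt_pos hxy).ne', ← e']
  ring

theorem sum_mul_dy (h : IsLocalRanders U D f a b) (hxy : (x, y) ∈ D) :
    ∑ k, y k * dy k f x y = f x y := by
  simp only [h.dy_eq hxy, h.eq x y hxy, mul_add, Finset.sum_add_distrib]
  congr 1
  · have e : ∑ k, y k * ((∑ j, a x k j * y j) / √(quad a x y)) = quad a x y / √(quad a x y) := by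
      simp only [quad, Finset.sum_div, Finset.mul_sum]
      exact Finset.sum_congr rfl fun i _ => Finset.sum_congr rfl fun j _ => by ring
    rw [e, Real.div_sqrt]
  · exact Finset.sum_congr rfl fun i _ => mul_comm _ _

/-! #### The fundamental tensor -/

theorem smoothOn_sqFun (h : IsLocalRanders U D f a b) : SmoothOn D (sqFun f) :=
  h.smoothOn.pow 2

theorem dx_sqFun (h : IsLocalRanders U D f a b) (hxy : (x, y) ∈ D) (i : Fin 4) :
    dx i (sqFun f) x y = 2 * f x y * dx i f x y := by
  have e : sqFun f = fun x y => f x y * f x y := by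
    ext x y
    exact pow_two _
  rw [e, dx_mul h.isOpen hxy h.smoothOn h.smoothOn]
  ring

theorem dy_sqFun (h : IsLocalRanders U D f a b) (hxy : (x, y) ∈ D) (i : Fin 4) :
    dy i (sqFun f) x y = 2 * f x y * dy i f x y := by
  have e : sqFun f = fun x y => f x y * f x y := by
    ext x y
    exact pow_two _
  rw [e, dy_mul h.isOpen hxy h.smoothOn h.smoothOn]
  ring

theorem fundamentalTensor_apply (h : IsLocalRanders U D f a b) (hxy : (x, y) ∈ D) (i j : Fin 4) :
    fundamentalTensor f x y i j = (1 / 2) * dy i (dy j (sqFun f)) x y := by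
  have e : ∀ x y, (x, y) ∈ D →
      dy j (fun x y => (1 / 2 : ℝ) * f x y ^ 2) x y = (1 / 2) * dy j (sqFun f) x y := by
    intro x y hxy
    have := dy_mul h.isOpen hxy (SmoothOn.const (1 / 2)) h.smoothOn_sqFun j
    rw [dy_base, zero_mul, zero_add] at this
    exact this
  rw [fundamentalTensor, Matrix.of_apply, dy_congr h.isOpen e hxy,
    dy_mul h.isOpen hxy (SmoothOn.const (1 / 2)) (h.smoothOn_sqFun.dy h.isOpen j), dy_base,
    zero_mul, zero_add]

theorem fundamentalTensor_symm (h : IsLocalRanders U D f a b) (hxy : (x, y) ∈ D) (i j : Fin 4) :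
    fundamentalTensor f x y i j = fundamentalTensor f x y j i := by
  rw [h.fundamentalTensor_apply hxy, h.fundamentalTensor_apply hxy,
    h.smoothOn_sqFun.dy_dy_comm h.isOpen hxy]

/-- The unit vector `y / α`. -/
noncomputable def unitVec (a : Coord → Matrix (Fin 4) (Fin 4) ℝ) (x y : Coord) : Fin 4 → ℝ :=
  fun i => y i / √(quad a x y)

theorem mulVec_unitVec (i : Fin 4) :
    (a x *ᵥ unitVec a x y) i = (∑ j, a x i j * y j) / √(quad a x y) := by
  simp only [Matrix.mulVec, dotProduct, unitVec, Finset.sum_div, mul_div_assoc]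

theorem unitVec_dotProduct_mulVec (h : IsLocalRanders U D f a b) (hxy : (x, y) ∈ D) :
    unitVec a x y ⬝ᵥ a x *ᵥ unitVec a x y = 1 := by
  have h0 := (h.sqrt_pos hxy).ne'
  have e : unitVec a x y ⬝ᵥ a x *ᵥ unitVec a x y =
      quad a x y / (√(quad a x y) * √(quad a x y)) := by
    simp only [dotProduct, mulVec_unitVec]
    simp only [unitVec, quad, Finset.sum_div, Finset.mul_sum]
    refine Finset.sum_congr rfl fun i _ => Finset.sum_congr rfl fun j _ => ?_
    field_simp
  rw [e, h.sqrt_mul_self hxy, div_self (h.quad_pos x y hxy).ne']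

open Matrix in
-- This is `g = F ∂∂F + ∂F ∂F`, with `∂F = u + b` and `∂∂F = (a - u uᵀ) / α`, where `u = a(y / α,
-- ·)`.
theorem fundamentalTensor_eq (h : IsLocalRanders U D f a b) (hxy : (x, y) ∈ D) :
    fundamentalTensor f x y = (f x y / √(quad a x y)) •
        (a x - vecMulVec (a x *ᵥ unitVec a x y) (a x *ᵥ unitVec a x y)) +
      vecMulVec (a x *ᵥ unitVec a x y + fun i => b i x)
        (a x *ᵥ unitVec a x y + fun i => b i x) := by
  ext i j
  have h2 : SmoothOn D fun x y => 2 * f x y := (SmoothOn.const 2).mul h.smoothOn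
  rw [h.fundamentalTensor_apply hxy,
    dy_congr h.isOpen (fun x y hxy => h.dy_sqFun hxy j) hxy,
    dy_mul h.isOpen hxy h2 (h.smoothOn.dy h.isOpen j),
    dy_mul h.isOpen hxy (SmoothOn.const 2) h.smoothOn, dy_base, h.dy_dy_eq hxy, h.dy_eq hxy,
    h.dy_eq hxy]
  simp only [Matrix.add_apply, Matrix.smul_apply, Matrix.sub_apply, vecMulVec_apply,
    Pi.add_apply, mulVec_unitVec, smul_eq_mul]
  ring

/-- At a zero of `F` the fundamental tensor would have rank at most one, hence be degenerate. -/
theorem pos (h : IsLocalRanders U D f a b) (hxy : (x, y) ∈ D) : 0 < f x y := by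
  refine lt_of_le_of_ne (h.nonneg x y hxy) fun h0 => (h.lorentzian x y hxy).det_ne_zero ?_
  rw [h.fundamentalTensor_eq hxy, ← h0, zero_div, zero_smul, zero_add, Matrix.det_vecMulVec]

theorem exists_quad_neg (h : IsLocalRanders U D f a b) (hx : x ∈ U) : ∃ v, quad a x v < 0 := by
  obtain ⟨y, hxy⟩ := h.fiber_nonempty x hx
  obtain ⟨z, hz⟩ := (h.lorentzian x y hxy).exists_neg
  rw [h.fundamentalTensor_eq hxy] at hz
  obtain ⟨v, hv⟩ := exists_neg_of_randers (h.metric.transpose_eq hx)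
    (div_pos (h.pos hxy) (h.sqrt_pos hxy)) (h.unitVec_dotProduct_mulVec hxy) hz
  refine ⟨WithLp.toLp 2 v, lt_of_eq_of_lt ?_ hv⟩
  simp only [quad, dotProduct, Matrix.mulVec, Finset.mul_sum]
  exact Finset.sum_congr rfl fun i _ => Finset.sum_congr rfl fun j _ => by ring

theorem eventually_mem (h : IsLocalRanders U D f a b) (hxy : (x, y) ∈ D) :
    ∀ᶠ z in nhds y, (x, z) ∈ D :=
  (h.isOpen.preimage (by fun_prop : Continuous fun z : Coord => (x, z))).mem_nhds hxy

/-- A relation `α p₁ = p₂` between analytic functions of `y` on a fibre of `D` is trivial. -/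
theorem eq_zero_of_sqrt_quad_mul_eq (h : IsLocalRanders U D f a b) (hx : x ∈ U)
    {p₁ p₂ : Coord → ℝ} (h₁ : ∀ z, AnalyticAt ℝ p₁ z) (h₂ : ∀ z, AnalyticAt ℝ p₂ z)
    (heq : ∀ z, (x, z) ∈ D → √(quad a x z) * p₁ z = p₂ z) (z : Coord) : p₁ z = 0 ∧ p₂ z = 0 := by
  obtain ⟨y, hxy⟩ := h.fiber_nonempty x hx
  obtain ⟨v, hv⟩ := h.exists_quad_neg hx
  exact eq_zero_of_sqrt_mul_eq (analyticAt_quadratic (a x)) h₁ h₂ hv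
    ((h.eventually_mem hxy).mono fun z hz => ⟨h.quad_pos x z hz, heq z hz⟩) z

end IsLocalRanders

/-! ### The Cartan connection of a Randers metric -/

/-- The covector `yˡ ∂²F²/∂xˡ∂yᵏ - ∂F²/∂xᵏ`. -/
noncomputable def sprayCovector (f : Coord → Coord → ℝ) (k : Fin 4) : Coord → Coord → ℝ :=
  fun x y => (∑ l, y l * dx l (dy k (sqFun f)) x y) - dx k (sqFun f) x y

/-- Four times the geodesic spray coefficients. -/
noncomputable def spray (f : Coord → Coord → ℝ) (i : Fin 4) : Coord → Coord → ℝ :=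
  fun x y => ∑ k, (fundamentalTensor f x y)⁻¹ i k * sprayCovector f k x y

theorem cartanConnection_eq (f : Coord → Coord → ℝ) (i j : Fin 4) (x y : Coord) :
    cartanConnection f i j x y = (1 / 4) * dy j (spray f i) x y := rfl

/-- `F` is Berwald on `D`, with connection coefficients `Γ`. -/
def IsBerwaldOn (D : Set (Coord × Coord)) (f : Coord → Coord → ℝ)
    (Γ : Fin 4 → Fin 4 → Fin 4 → Coord → ℝ) : Prop :=
  ∀ x y, (x, y) ∈ D → ∀ i j, cartanConnection f i j x y = ∑ k, Γ i j k x * y k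

namespace IsLocalRanders

variable {U : Set Coord} {D : Set (Coord × Coord)} {f : Coord → Coord → ℝ}
  {a : Coord → Matrix (Fin 4) (Fin 4) ℝ} {b : Fin 4 → Coord → ℝ} {x y : Coord}

theorem smoothOn_fundamentalTensor (h : IsLocalRanders U D f a b) (i j : Fin 4) :
    SmoothOn D (fun x y => fundamentalTensor f x y i j) :=
  ((SmoothOn.const (1 / 2)).mul ((h.smoothOn_sqFun.dy h.isOpen j).dy h.isOpen i)).congr
    fun _ _ hxy => h.fundamentalTensor_apply hxy i j

theorem smoothOn_sprayCovector (h : IsLocalRanders U D f a b) (k : Fin 4) :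
    SmoothOn D (sprayCovector f k) :=
  (SmoothOn.sum fun l _ => (SmoothOn.fiberCoord l).mul
    ((h.smoothOn_sqFun.dy h.isOpen k).dx h.isOpen l)).sub (h.smoothOn_sqFun.dx h.isOpen k)

theorem smoothOn_spray (h : IsLocalRanders U D f a b) (i : Fin 4) : SmoothOn D (spray f i) :=
  SmoothOn.sum fun k _ => SmoothOn.mul
    (contDiffOn_matrix_inv (A := fun p : Coord × Coord => fundamentalTensor f p.1 p.2)
      h.smoothOn_fundamentalTensor (fun p hp => (h.lorentzian p.1 p.2 hp).det_ne_zero) i k)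
    (h.smoothOn_sprayCovector k)

theorem sum_fundamentalTensor_mul_spray (h : IsLocalRanders U D f a b) (hxy : (x, y) ∈ D)
    (k : Fin 4) : ∑ m, fundamentalTensor f x y k m * spray f m x y = sprayCovector f k x y := by
  have e : fundamentalTensor f x y *ᵥ ((fundamentalTensor f x y)⁻¹ *ᵥ
      fun k => sprayCovector f k x y) = fun k => sprayCovector f k x y := by
    rw [Matrix.mulVec_mulVec, Matrix.mul_nonsing_inv _
      (isUnit_iff_ne_zero.2 (h.lorentzian x y hxy).det_ne_zero), Matrix.one_mulVec]
  exact congrFun e k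

theorem sum_mul_dy_sqFun (h : IsLocalRanders U D f a b) (hxy : (x, y) ∈ D) :
    ∑ k, y k * dy k (sqFun f) x y = 2 * sqFun f x y := by
  have e : ∀ k, y k * dy k (sqFun f) x y = 2 * f x y * (y k * dy k f x y) := fun k => by
    rw [h.dy_sqFun hxy]
    ring
  simp only [e, ← Finset.mul_sum, h.sum_mul_dy hxy, sqFun]
  ring

theorem sum_mul_dx_dy_sqFun (h : IsLocalRanders U D f a b) (hxy : (x, y) ∈ D) (l : Fin 4) :
    ∑ k, y k * dx l (dy k (sqFun f)) x y = 2 * dx l (sqFun f) x y := by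
  have e := dx_congr h.isOpen (fun x y hxy => h.sum_mul_dy_sqFun hxy) hxy l
  rw [dx_sum h.isOpen hxy fun k _ => (SmoothOn.fiberCoord k).mul (h.smoothOn_sqFun.dy h.isOpen k),
    dx_mul h.isOpen hxy (SmoothOn.const 2) h.smoothOn_sqFun] at e
  simp only [dx_mul h.isOpen hxy (SmoothOn.fiberCoord _) (h.smoothOn_sqFun.dy h.isOpen _),
    dx_fiber fun y : Coord => y _, zero_mul, zero_add] at e
  rw [e, dx_base, pd_const, zero_mul, zero_add]

theorem sum_mul_dy_dy_sqFun (h : IsLocalRanders U D f a b) (hxy : (x, y) ∈ D) (m : Fin 4) :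
    ∑ k, y k * dy m (dy k (sqFun f)) x y = dy m (sqFun f) x y := by
  have e := dy_congr h.isOpen (fun x y hxy => h.sum_mul_dy_sqFun hxy) hxy m
  rw [dy_sum h.isOpen hxy fun k _ => (SmoothOn.fiberCoord k).mul (h.smoothOn_sqFun.dy h.isOpen k),
    dy_mul h.isOpen hxy (SmoothOn.const 2) h.smoothOn_sqFun, dy_base] at e
  simp only [dy_mul h.isOpen hxy (SmoothOn.fiberCoord _) (h.smoothOn_sqFun.dy h.isOpen _),
    dy_fiberCoord, Finset.sum_add_distrib, ite_mul, one_mul, zero_mul, Finset.sum_ite_eq',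
    Finset.mem_univ, if_true, zero_add] at e
  linarith

/-- The equation defining the spray contracted with `y`; Euler's identity for the 2-homogeneous `F²`
simplifies both sides. -/
theorem sum_dy_sqFun_mul_spray (h : IsLocalRanders U D f a b) (hxy : (x, y) ∈ D) :
    ∑ m, dy m (sqFun f) x y * spray f m x y = 2 * ∑ l, y l * dx l (sqFun f) x y := by
  have e1 : ∑ k, y k * sprayCovector f k x y = ∑ l, y l * dx l (sqFun f) x y := by
    have : ∑ k, y k * ∑ l, y l * dx l (dy k (sqFun f)) x y =
        ∑ l, y l * ∑ k, y k * dx l (dy k (sqFun f)) x y := by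
      simp only [Finset.mul_sum]
      rw [Finset.sum_comm]
      exact Finset.sum_congr rfl fun i _ => Finset.sum_congr rfl fun j _ => by ring
    simp only [sprayCovector, mul_sub, Finset.sum_sub_distrib]
    rw [this, ← Finset.sum_sub_distrib]
    simp only [h.sum_mul_dx_dy_sqFun hxy]
    exact Finset.sum_congr rfl fun i _ => by ring
  have e2 : ∑ k, y k * sprayCovector f k x y =
      (1 / 2) * ∑ m, dy m (sqFun f) x y * spray f m x y := by
    simp only [← h.sum_fundamentalTensor_mul_spray hxy, ← h.sum_mul_dy_dy_sqFun hxy,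
      Finset.mul_sum, Finset.sum_mul]
    rw [Finset.sum_comm]
    refine Finset.sum_congr rfl fun m _ => Finset.sum_congr rfl fun k _ => ?_
    rw [h.fundamentalTensor_symm hxy k m, h.fundamentalTensor_apply hxy]
    ring
  linarith

/-- `F²` is constant along the horizontal directions of the Cartan connection. -/
theorem sum_cartanConnection_mul_dy_sqFun (h : IsLocalRanders U D f a b) (hxy : (x, y) ∈ D)
    (i : Fin 4) :
    ∑ m, cartanConnection f m i x y * dy m (sqFun f) x y = dx i (sqFun f) x y := by
  have hL := h.smoothOn_sqFun
  -- In the `yⁱ`-derivative of this identity, the terms with second derivatives of `F²` cancel by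
  -- the spray equation.
  have e := dy_congr h.isOpen (fun x y hxy => h.sum_dy_sqFun_mul_spray hxy) hxy i
  have hs : SmoothOn D fun x y => ∑ l, y l * dx l (sqFun f) x y :=
    SmoothOn.sum fun l _ => (SmoothOn.fiberCoord l).mul (hL.dx h.isOpen l)
  rw [dy_sum h.isOpen hxy fun m _ => (hL.dy h.isOpen m).mul (h.smoothOn_spray m),
    dy_mul h.isOpen hxy (SmoothOn.const 2) hs, dy_base,
    dy_sum h.isOpen hxy fun l _ => (SmoothOn.fiberCoord l).mul (hL.dx h.isOpen l)] at e
  simp only [dy_mul h.isOpen hxy (SmoothOn.fiberCoord _) (hL.dx h.isOpen _),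
    dy_mul h.isOpen hxy (hL.dy h.isOpen _) (h.smoothOn_spray _), hL.dy_dx_comm h.isOpen hxy,
    dy_fiberCoord, Finset.sum_add_distrib, ite_mul, one_mul, zero_mul, Finset.sum_ite_eq',
    Finset.mem_univ, if_true, zero_add] at e
  have e1 : ∑ m, dy i (dy m (sqFun f)) x y * spray f m x y = 2 * sprayCovector f i x y := by
    rw [← h.sum_fundamentalTensor_mul_spray hxy, Finset.mul_sum]
    refine Finset.sum_congr rfl fun m _ => ?_
    rw [h.fundamentalTensor_apply hxy]
    ring
  have e2 : ∑ m, dy m (sqFun f) x y * dy i (spray f m) x y =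
      4 * ∑ m, cartanConnection f m i x y * dy m (sqFun f) x y := by
    rw [Finset.mul_sum]
    refine Finset.sum_congr rfl fun m _ => ?_
    rw [cartanConnection_eq]
    ring
  rw [e1, e2, sprayCovector] at e
  linarith

theorem sum_cartanConnection_mul_dy (h : IsLocalRanders U D f a b) (hxy : (x, y) ∈ D)
    (i : Fin 4) : ∑ m, cartanConnection f m i x y * dy m f x y = dx i f x y := by
  have e := h.sum_cartanConnection_mul_dy_sqFun hxy i
  rw [h.dx_sqFun hxy] at e
  have e' : ∑ m, cartanConnection f m i x y * dy m (sqFun f) x y =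
      2 * f x y * ∑ m, cartanConnection f m i x y * dy m f x y := by
    rw [Finset.mul_sum]
    refine Finset.sum_congr rfl fun m _ => ?_
    rw [h.dy_sqFun hxy]
    ring
  rw [e'] at e
  exact mul_left_cancel₀ (mul_ne_zero two_ne_zero (h.pos hxy).ne') e

/-! #### Berwald implies parallel -/

/-- `Γⁱⱼₖ` is a quarter of the second `y`-derivative of the `i`-th spray component. -/
theorem berwald_symm (h : IsLocalRanders U D f a b) {Γ : Fin 4 → Fin 4 → Fin 4 → Coord → ℝ}
    (hB : IsBerwaldOn D f Γ) (hx : x ∈ U) (i j k : Fin 4) : Γ i j k x = Γ i k j x := by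
  obtain ⟨y, hxy⟩ := h.fiber_nonempty x hx
  have key : ∀ j k, (1 / 4) * dy k (dy j (spray f i)) x y = Γ i j k x := by
    intro j k
    have e := dy_congr h.isOpen (g := lin (Γ i j)) (fun x y hxy => hB x y hxy i j) hxy k
    have e' := dy_mul h.isOpen hxy (SmoothOn.const (1 / 4))
      ((h.smoothOn_spray i).dy h.isOpen j) k
    rw [dy_base, zero_mul, zero_add] at e'
    rw [← e', ← dy_lin (Γ i j) k x y, ← e]
    rfl
  rw [← key, ← key, (h.smoothOn_spray i).dy_dy_comm h.isOpen hxy]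

/-- Horizontal constancy of `F = α + β`, multiplied by `2α` and sorted into a multiple of `α` and
the rest. -/
theorem sqrt_mul_eq_of_berwald (h : IsLocalRanders U D f a b) {Γ : Fin 4 → Fin 4 → Fin 4 → Coord → ℝ}
    (hB : IsBerwaldOn D f Γ) (hxy : (x, y) ∈ D) (i : Fin 4) :
    √(quad a x y) * ∑ j, (-2 * (pd i (b j) x - ∑ m, Γ m i j x * b m x)) * y j =
      ∑ j, ∑ k, (pd i (fun x => a x j k) x - 2 * ∑ m, a x j m * Γ m i k x) * y j * y k := by
  have hα := (h.sqrt_pos hxy).ne'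
  have e := h.sum_cartanConnection_mul_dy hxy i
  simp only [hB x y hxy, h.dx_eq hxy, h.dy_eq hxy, mul_add, Finset.sum_add_distrib] at e
  have e1 : ∑ m, (∑ k, Γ m i k x * y k) * ((∑ j, a x m j * y j) / √(quad a x y)) =
      (∑ j, ∑ k, (∑ m, a x j m * Γ m i k x) * y j * y k) / √(quad a x y) := by
    simp only [Finset.sum_div, Finset.sum_mul, Finset.mul_sum]
    conv_rhs => enter [2, j]; rw [Finset.sum_comm]
    rw [Finset.sum_comm (f := fun j m => _)]
    refine Finset.sum_congr rfl fun m _ => ?_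
    refine Finset.sum_congr rfl fun j _ => Finset.sum_congr rfl fun k _ => ?_
    rw [h.metric.symm x (h.fst_mem _ hxy) j m]
    ring
  have e2 : ∑ m, (∑ k, Γ m i k x * y k) * b m x = ∑ j, (∑ m, Γ m i j x * b m x) * y j := by
    simp only [Finset.sum_mul]
    rw [Finset.sum_comm]
    exact Finset.sum_congr rfl fun j _ => Finset.sum_congr rfl fun k _ => by ring
  have e3 : ∑ j, (-2 * (pd i (b j) x - ∑ m, Γ m i j x * b m x)) * y j =
      -2 * ∑ j, pd i (b j) x * y j + 2 * ∑ j, (∑ m, Γ m i j x * b m x) * y j := by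
    rw [Finset.mul_sum, Finset.mul_sum, ← Finset.sum_add_distrib]
    exact Finset.sum_congr rfl fun j _ => by ring
  have e4 : ∑ j, ∑ k, (pd i (fun x => a x j k) x - 2 * ∑ m, a x j m * Γ m i k x) * y j * y k =
      ∑ j, ∑ k, pd i (fun x => a x j k) x * y j * y k -
        2 * ∑ j, ∑ k, (∑ m, a x j m * Γ m i k x) * y j * y k := by
    simp only [Finset.mul_sum (s := Finset.univ) (a := (2 : ℝ)) (f := fun j => ∑ k, _),
      ← Finset.sum_sub_distrib]
    refine Finset.sum_congr rfl fun j _ => ?_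
    rw [Finset.mul_sum, ← Finset.sum_sub_distrib]
    exact Finset.sum_congr rfl fun k _ => by ring
  rw [e1, e2] at e
  rw [e3, e4]
  field_simp at e
  linarith

theorem berwald_metric_and_parallel (h : IsLocalRanders U D f a b)
    {Γ : Fin 4 → Fin 4 → Fin 4 → Coord → ℝ} (hB : IsBerwaldOn D f Γ) (hx : x ∈ U) (i : Fin 4) :
    (∀ j, pd i (b j) x - ∑ m, Γ m i j x * b m x = 0) ∧
      ∀ j k, pd i (fun x => a x j k) x = ∑ m, a x j m * Γ m i k x + ∑ m, a x k m * Γ m i j x := by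
  have key := h.eq_zero_of_sqrt_quad_mul_eq hx (analyticAt_linear _) (analyticAt_quadratic _)
    fun z hz => h.sqrt_mul_eq_of_berwald hB hz i
  refine ⟨fun j => ?_, fun j k => ?_⟩
  · have := linear_eq_zero (fun z => (key z).1) j
    linarith
  · have := quadratic_eq_zero (fun z => (key z).2) j k
    rw [h.metric.pd_symm hx i k j] at this
    linarith

theorem christoffel_eq_of_berwald (h : IsLocalRanders U D f a b)
    {Γ : Fin 4 → Fin 4 → Fin 4 → Coord → ℝ} (hB : IsBerwaldOn D f Γ) (hx : x ∈ U)
    (i j k : Fin 4) : christoffel a i j k x = Γ i j k x :=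
  h.metric.christoffel_eq hx (Γ := fun i j k => Γ i j k x) (fun i j k => h.berwald_symm hB hx i j k)
    (fun i j k => (h.berwald_metric_and_parallel hB hx i).2 j k) i j k

theorem isParallelOn_of_berwald (h : IsLocalRanders U D f a b)
    {Γ : Fin 4 → Fin 4 → Fin 4 → Coord → ℝ} (hB : IsBerwaldOn D f Γ) : IsParallelOn U a b := by
  intro x hx i j
  simp only [h.christoffel_eq_of_berwald hB hx]
  exact (h.berwald_metric_and_parallel hB hx i).1 j

/-! #### Parallel implies Berwald -/

/-- The nonlinear connection `Γⁱⱼₖ yᵏ` of the Levi-Civita connection. -/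
theorem smoothOn_lin_christoffel (h : IsLocalRanders U D f a b) (i j : Fin 4) :
    SmoothOn D (lin (christoffel a i j)) :=
  SmoothOn.sum fun k _ => (SmoothOn.of_base (h.metric.contDiffOn_christoffel i j k) h.fst_mem).mul
    (SmoothOn.fiberCoord k)

/-- The Levi-Civita connection preserves both `a` and `b`, hence `F`. -/
theorem dx_eq_of_parallel (h : IsLocalRanders U D f a b) (hb : IsParallelOn U a b)
    (hxy : (x, y) ∈ D) (i : Fin 4) :
    dx i f x y = ∑ m, lin (christoffel a m i) x y * dy m f x y := by
  have hx : x ∈ U := h.fst_mem _ hxy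
  have hα := (h.sqrt_pos hxy).ne'
  simp only [h.dx_eq hxy, h.dy_eq hxy, mul_add, Finset.sum_add_distrib]
  congr 1
  · have e1 : ∑ m, lin (christoffel a m i) x y * ((∑ j, a x m j * y j) / √(quad a x y)) =
        (∑ j, ∑ k, (∑ m, a x j m * christoffel a m i k x) * y j * y k) / √(quad a x y) := by
      simp only [lin, Finset.sum_div, Finset.sum_mul, Finset.mul_sum]
      conv_rhs => enter [2, j]; rw [Finset.sum_comm]
      rw [Finset.sum_comm (f := fun j m => _)]
      refine Finset.sum_congr rfl fun m _ => ?_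
      refine Finset.sum_congr rfl fun j _ => Finset.sum_congr rfl fun k _ => ?_
      rw [h.metric.symm x hx j m]
      ring
    have e2 : ∑ j, ∑ k, (∑ m, a x k m * christoffel a m i j x) * y j * y k =
        ∑ j, ∑ k, (∑ m, a x j m * christoffel a m i k x) * y j * y k := by
      rw [Finset.sum_comm]
      exact Finset.sum_congr rfl fun j _ => Finset.sum_congr rfl fun k _ => by ring
    rw [e1]
    simp only [h.metric.pd_eq hx, add_mul, Finset.sum_add_distrib, e2]
    field_simp
    ring
  · have e : ∀ j, pd i (b j) x = ∑ m, christoffel a m i j x * b m x := fun j =>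
      sub_eq_zero.1 (hb x hx i j)
    simp only [e, lin, Finset.sum_mul]
    rw [Finset.sum_comm]
    exact Finset.sum_congr rfl fun j _ => Finset.sum_congr rfl fun k _ => by ring

theorem dx_sqFun_of_parallel (h : IsLocalRanders U D f a b) (hb : IsParallelOn U a b)
    (hxy : (x, y) ∈ D) (i : Fin 4) :
    dx i (sqFun f) x y = ∑ m, lin (christoffel a m i) x y * dy m (sqFun f) x y := by
  rw [h.dx_sqFun hxy, h.dx_eq_of_parallel hb hxy, Finset.mul_sum]
  refine Finset.sum_congr rfl fun m _ => ?_
  rw [h.dy_sqFun hxy]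
  ring

/-- Take the `yᵏ`-derivative of the horizontal constancy of `F²` and contract with `y`. By symmetry
of `Γ`, the terms in first derivatives of `F²` cancel `∂F²/∂xᵏ`. -/
theorem sprayCovector_of_parallel (h : IsLocalRanders U D f a b) (hb : IsParallelOn U a b)
    (hxy : (x, y) ∈ D) (k : Fin 4) :
    sprayCovector f k x y = ∑ m, fundamentalTensor f x y k m *
      (2 * ∑ l, lin (christoffel a m l) x y * y l) := by
  have hx : x ∈ U := h.fst_mem _ hxy
  have hL := h.smoothOn_sqFun
  have key : ∀ l, dx l (dy k (sqFun f)) x y = ∑ m, christoffel a m l k x * dy m (sqFun f) x y +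
      ∑ m, lin (christoffel a m l) x y * (2 * fundamentalTensor f x y k m) := by
    intro l
    rw [← hL.dy_dx_comm h.isOpen hxy,
      dy_congr h.isOpen (fun x y hxy => h.dx_sqFun_of_parallel hb hxy l) hxy,
      dy_sum h.isOpen hxy fun m _ => (h.smoothOn_lin_christoffel m l).mul (hL.dy h.isOpen m)]
    simp only [dy_mul h.isOpen hxy (h.smoothOn_lin_christoffel _ l) (hL.dy h.isOpen _), dy_lin,
      Finset.sum_add_distrib, h.fundamentalTensor_apply hxy]
    congr 1
    exact Finset.sum_congr rfl fun m _ => by ring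
  rw [sprayCovector, h.dx_sqFun_of_parallel hb hxy]
  simp only [key, mul_add, Finset.sum_add_distrib]
  have e1 : ∑ l, y l * ∑ m, christoffel a m l k x * dy m (sqFun f) x y =
      ∑ m, lin (christoffel a m k) x y * dy m (sqFun f) x y := by
    simp only [lin, Finset.mul_sum, Finset.sum_mul]
    rw [Finset.sum_comm]
    refine Finset.sum_congr rfl fun m _ => Finset.sum_congr rfl fun l _ => ?_
    rw [h.metric.christoffel_symm hx m l k]
    ring
  rw [e1, add_sub_cancel_left]
  simp only [Finset.mul_sum]
  rw [Finset.sum_comm]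
  exact Finset.sum_congr rfl fun m _ => Finset.sum_congr rfl fun l _ => by ring

theorem spray_of_parallel (h : IsLocalRanders U D f a b) (hb : IsParallelOn U a b)
    (hxy : (x, y) ∈ D) (i : Fin 4) :
    spray f i x y = 2 * ∑ l, lin (christoffel a i l) x y * y l := by
  have e : (fundamentalTensor f x y)⁻¹ *ᵥ (fundamentalTensor f x y *ᵥ
      fun m => 2 * ∑ l, lin (christoffel a m l) x y * y l) =
        fun m => 2 * ∑ l, lin (christoffel a m l) x y * y l := by
    rw [Matrix.mulVec_mulVec, Matrix.nonsing_inv_mul _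
      (isUnit_iff_ne_zero.2 (h.lorentzian x y hxy).det_ne_zero), Matrix.one_mulVec]
  rw [← congrFun e i]
  simp only [spray, h.sprayCovector_of_parallel hb hxy]
  rfl

theorem isBerwaldOn_of_parallel (h : IsLocalRanders U D f a b) (hb : IsParallelOn U a b) :
    IsBerwaldOn D f (christoffel a) := by
  intro x y hxy i j
  have hx : x ∈ U := h.fst_mem _ hxy
  have hs : ∀ l, SmoothOn D fun x y => lin (christoffel a i l) x y * y l := fun l =>
    (h.smoothOn_lin_christoffel i l).mul (SmoothOn.fiberCoord l)
  rw [cartanConnection_eq, dy_congr h.isOpen (fun x y hxy => h.spray_of_parallel hb hxy i) hxy,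
    dy_mul h.isOpen hxy (SmoothOn.const 2) (SmoothOn.sum fun l _ => hs l), dy_base,
    dy_sum h.isOpen hxy fun l _ => hs l]
  simp only [dy_mul h.isOpen hxy (h.smoothOn_lin_christoffel i _) (SmoothOn.fiberCoord _), dy_lin,
    dy_fiberCoord, Finset.sum_add_distrib, mul_ite, mul_one, mul_zero, Finset.sum_ite_eq',
    Finset.mem_univ, if_true, h.metric.christoffel_symm hx i _ j]
  simp only [lin]
  ring

end IsLocalRanders

namespace IsLocalRanders

variable {U : Set Coord} {D : Set (Coord × Coord)} {f : Coord → Coord → ℝ}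
  {a : Coord → Matrix (Fin 4) (Fin 4) ℝ} {b : Fin 4 → Coord → ℝ} {x y : Coord}

/-! #### The Finsler Ricci tensor -/

theorem dx_lin_christoffel (h : IsLocalRanders U D f a b) (hxy : (x, y) ∈ D) (i j l : Fin 4) :
    dx l (lin (christoffel a i j)) x y = ∑ k, pd l (christoffel a i j k) x * y k := by
  have hs : ∀ k, SmoothOn D fun x _ => christoffel a i j k x := fun k =>
    SmoothOn.of_base (h.metric.contDiffOn_christoffel i j k) h.fst_mem
  have e : dx l (lin (christoffel a i j)) x y =
    dx l (fun x y => ∑ k, christoffel a i j k x * y k) x y := rfl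
  rw [e, dx_sum h.isOpen hxy fun k _ => (hs k).mul (SmoothOn.fiberCoord k)]
  simp only [dx_mul h.isOpen hxy (hs _) (SmoothOn.fiberCoord _),
    dx_fiber fun y : Coord => y _, mul_zero, add_zero]
  rfl

theorem horizontalDeriv_cartanConnection (h : IsLocalRanders U D f a b)
    (hB : IsBerwaldOn D f (christoffel a)) (hxy : (x, y) ∈ D) (i j k : Fin 4) :
    horizontalDeriv f j (cartanConnection f i k) x y =
      ∑ l, (pd j (christoffel a i k l) x -
        ∑ m, christoffel a i k m x * christoffel a m j l x) * y l := by
  have e : ∀ x y, (x, y) ∈ D → cartanConnection f i k x y = lin (christoffel a i k) x y :=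
    fun x y hxy => hB x y hxy i k
  have e1 : ∀ m, dy m (cartanConnection f i k) x y = christoffel a i k m x := fun m => by
    rw [dy_congr h.isOpen e hxy, dy_lin]
  have e2 : ∑ m, (∑ l, christoffel a m j l x * y l) * christoffel a i k m x =
      ∑ l, (∑ m, christoffel a i k m x * christoffel a m j l x) * y l := by
    simp only [Finset.sum_mul]
    rw [Finset.sum_comm]
    exact Finset.sum_congr rfl fun l _ => Finset.sum_congr rfl fun m _ => by ring
  have e3 : ∀ m, cartanConnection f m j x y = ∑ l, christoffel a m j l x * y l :=
    fun m => hB x y hxy m j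
  rw [horizontalDeriv, dx_congr h.isOpen e hxy, h.dx_lin_christoffel hxy]
  simp only [e1, e3, e2, sub_mul, Finset.sum_sub_distrib]

theorem finslerCurvature_eq (h : IsLocalRanders U D f a b)
    (hB : IsBerwaldOn D f (christoffel a)) (hxy : (x, y) ∈ D) (i j k : Fin 4) :
    finslerCurvature f i j k x y = ∑ l, riemann a l i j k x * y l := by
  have hx : x ∈ U := h.fst_mem _ hxy
  rw [finslerCurvature, h.horizontalDeriv_cartanConnection hB hxy,
    h.horizontalDeriv_cartanConnection hB hxy, ← Finset.sum_sub_distrib]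
  refine Finset.sum_congr rfl fun l _ => ?_
  rw [riemann, ← sub_mul, Finset.sum_sub_distrib]
  simp only [h.metric.christoffel_symm hx i j, h.metric.christoffel_symm hx i k]
  ring

theorem finslerRic_eq (h : IsLocalRanders U D f a b)
    (hB : IsBerwaldOn D f (christoffel a)) (hxy : (x, y) ∈ D) :
    finslerRic f x y = quad (fun x => Matrix.of fun i j => ricci a i j x) x y := by
  simp only [finslerRic, h.finslerCurvature_eq hB hxy, quad, Matrix.of_apply, ricci,
    Finset.sum_mul]
  rw [Finset.sum_comm]
  conv_lhs => enter [2, j]; rw [Finset.sum_comm]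
  rw [Finset.sum_comm]

/-- Half the Hessian of `Ric(y, y)` is the symmetrized Ricci tensor, so the symmetry of Ricci is
needed. -/
theorem finslerRicciTensor_eq (h : IsLocalRanders U D f a b)
    (hB : IsBerwaldOn D f (christoffel a)) (hxy : (x, y) ∈ D) (i j : Fin 4) :
    finslerRicciTensor f i j x y = ricci a i j x := by
  have e : ∀ x y, (x, y) ∈ D → dy j (finslerRic f) x y =
      lin (fun k x => ricci a j k x + ricci a k j x) x y := by
    intro x y hxy
    rw [dy_congr h.isOpen (fun x y hxy => h.finslerRic_eq hB hxy) hxy, dy_quad]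
    rfl
  rw [finslerRicciTensor, dy_congr h.isOpen e hxy, dy_lin,
    h.metric.ricci_symm (h.fst_mem _ hxy) j i]
  ring

/-! #### The vacuum equations -/

theorem sum_inv_mul_metric (h : IsMetricOn U a) (hx : x ∈ U) :
    ∑ i, ∑ j, (a x)⁻¹ i j * a x i j = 4 := by
  have e : ∀ i, ∑ j, (a x)⁻¹ i j * a x i j = 1 := fun i => by
    rw [← (h.sum_inv_mul hx i i).trans (if_pos rfl)]
    exact Finset.sum_congr rfl fun j _ => by rw [h.symm x hx i j]
  simp [e]

/-- A symmetric tensor proportional to the metric by the wrong multiple of its trace vanishes. -/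
theorem eq_zero_of_mul_eq_trace_mul (h : IsMetricOn U a) (hx : x ∈ U)
    {R : Fin 4 → Fin 4 → ℝ} {c : ℝ} (h0 : c ≠ 0) (h4 : c ≠ 4)
    (hR : ∀ i j, c * R i j = (∑ k, ∑ l, (a x)⁻¹ k l * R k l) * a x i j) (i j : Fin 4) :
    R i j = 0 := by
  set t := ∑ k, ∑ l, (a x)⁻¹ k l * R k l with ht
  have e : c * t = 4 * t := by
    rw [← sum_inv_mul_metric h hx, ht, Finset.mul_sum, Finset.sum_mul]
    refine Finset.sum_congr rfl fun k _ => ?_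
    rw [Finset.mul_sum, Finset.sum_mul]
    refine Finset.sum_congr rfl fun l _ => ?_
    rw [mul_left_comm, hR, ← ht]
    ring
  have ht0 : t = 0 := by
    by_contra hne
    exact h4 (mul_right_cancel₀ hne e)
  have := hR i j
  rw [ht0, zero_mul] at this
  exact (mul_eq_zero.1 this).resolve_left h0

/-- The trace by the explicit inverse of `g`, with `s = F / α` and `c = b♯`. As `R` annihilates `c`,
only `a⁻¹` and the square of the unit vector contribute. -/
theorem sum_inv_fundamentalTensor_mul (h : IsLocalRanders U D f a b) (hxy : (x, y) ∈ D)
    {R : Fin 4 → Fin 4 → ℝ} (hsymm : ∀ i j, R i j = R j i)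
    (hR : ∀ k, ∑ l, R l k * ((a x)⁻¹ *ᵥ fun j => b j x) l = 0) :
    f x y ^ 3 * ∑ i, ∑ j, (fundamentalTensor f x y)⁻¹ i j * R i j =
      √(quad a x y) * f x y ^ 2 * (∑ i, ∑ j, (a x)⁻¹ i j * R i j) +
        (√(quad a x y) * (((a x)⁻¹ *ᵥ fun j => b j x) ⬝ᵥ fun j => b j x) + lin b x y) *
          ∑ i, ∑ j, R i j * y i * y j := by
  have hx : x ∈ U := h.fst_mem _ hxy
  have hα := (h.sqrt_pos hxy).ne'
  have hf := (h.pos hxy).ne'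
  set c := (a x)⁻¹ *ᵥ fun j => b j x with hc
  have hac : a x *ᵥ c = fun j => b j x := h.metric.mulVec_inv_mulVec hx _
  have hvc : unitVec a x y ⬝ᵥ a x *ᵥ c = f x y / √(quad a x y) - 1 := by
    have : unitVec a x y ⬝ᵥ (fun j => b j x) = lin b x y / √(quad a x y) := by
      simp only [dotProduct, unitVec, lin, Finset.sum_div]
      exact Finset.sum_congr rfl fun i _ => by ring
    rw [hac, this, h.eq x y hxy]
    field_simp
    ring
  have hinv := randers_mul_inv (h.metric.transpose_eq hx) (h.metric.isUnit_det hx)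
    (div_ne_zero hf hα) (h.unitVec_dotProduct_mulVec hxy) hvc
  rw [hac, ← h.fundamentalTensor_eq hxy] at hinv
  rw [Matrix.inv_eq_right_inv hinv]
  have z1 : ∑ i, ∑ j, unitVec a x y i * c j * R i j = 0 := by
    refine Finset.sum_eq_zero fun i _ => ?_
    rw [← mul_zero (unitVec a x y i), ← hR i, Finset.mul_sum]
    exact Finset.sum_congr rfl fun j _ => by rw [hsymm i j]; ring
  have z2 : ∑ i, ∑ j, c i * unitVec a x y j * R i j = 0 := by
    rw [Finset.sum_comm, ← z1]
    exact Finset.sum_congr rfl fun i _ => Finset.sum_congr rfl fun j _ => by rw [hsymm i j]; ring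
  have z3 : ∑ i, ∑ j, unitVec a x y i * unitVec a x y j * R i j =
      (∑ i, ∑ j, R i j * y i * y j) / √(quad a x y) ^ 2 := by
    simp only [Finset.sum_div, unitVec]
    refine Finset.sum_congr rfl fun i _ => Finset.sum_congr rfl fun j _ => ?_
    field_simp
  have e : ∀ (s p q : ℝ) i j, (s • (a x)⁻¹ + p • Matrix.vecMulVec (unitVec a x y) (unitVec a x y) -
      q • (Matrix.vecMulVec (unitVec a x y) c + Matrix.vecMulVec c (unitVec a x y))) i j * R i j =
      s * ((a x)⁻¹ i j * R i j) + p * (unitVec a x y i * unitVec a x y j * R i j) -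
        (q * (unitVec a x y i * c j * R i j) + q * (c i * unitVec a x y j * R i j)) := by
    intro s p q i j
    simp only [Matrix.add_apply, Matrix.sub_apply, Matrix.smul_apply, Matrix.vecMulVec_apply,
      smul_eq_mul]
    ring
  simp only [e, Finset.sum_add_distrib, Finset.sum_sub_distrib, ← Finset.mul_sum, z1, z2, z3]
  rw [h.eq x y hxy] at hf ⊢
  field_simp
  ring

theorem ricci_eq_zero_of_vacuum (h : IsLocalRanders U D f a b) (hb : IsParallelOn U a b)
    (hx : x ∈ U) (hv : ∀ y, (x, y) ∈ D → ∑ i, ∑ j, ((fundamentalTensor f x y)⁻¹ i j -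
      3 / f x y ^ 2 * (y i * y j)) * finslerRicciTensor f i j x y = 0) (i j : Fin 4) :
    ricci a i j x = 0 := by
  have hB := h.isBerwaldOn_of_parallel hb
  set R : Fin 4 → Fin 4 → ℝ := fun i j => ricci a i j x with hRdef
  have hsymm : ∀ i j, R i j = R j i := h.metric.ricci_symm hx
  have hRc := hb.sum_ricci_mul_dual h.metric h.contDiffOn_form hx
  set t := ∑ i, ∑ j, (a x)⁻¹ i j * R i j with ht
  set B := ((a x)⁻¹ *ᵥ fun j => b j x) ⬝ᵥ fun j => b j x with hBdef
  set r : Coord → ℝ := fun y => ∑ i, ∑ j, R i j * y i * y j with hr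
  have haq := analyticAt_quadratic (a x)
  have hal := analyticAt_linear fun i => b i x
  have har := analyticAt_quadratic R
  -- With `t = tr Ric`, `r = Ric(y, y)` and `B = |b|²`, the equation times `F³` reads `3 F r = α F²
  -- t + (α B + β) r`. Expanding `F = α + β` and separating even from odd powers of `α` gives `α p₁
  -- = p₂`.
  have key := h.eq_zero_of_sqrt_quad_mul_eq hx
    (p₁ := fun z => (quad a x z + lin b x z ^ 2) * t + (B - 3) * r z)
    (p₂ := fun z => -2 * (lin b x z * (quad a x z * t - r z)))
    (fun z => (((haq z).add ((hal z).pow 2)).mul analyticAt_const).add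
      (analyticAt_const.mul (har z)))
    (fun z => analyticAt_const.mul ((hal z).mul (((haq z).mul analyticAt_const).sub (har z)))) ?_
  -- If `b` vanishes at `x`, then `p₂` is void and `p₁ = 0` reads `3 Ric = t a`. Otherwise `p₂ = 0`
  -- can be divided by `β` near a vector with `β ≠ 0`, and `Ric = t a` follows by analytic
  -- continuation. Taking traces gives `3t = 4t` or `t = 4t`.
  · by_cases hb0 : ∀ i, b i x = 0
    · have hl : ∀ z, lin b x z = 0 := fun z => by simp [lin, hb0]
      have hB0 : B = 0 := by simp [hBdef, hb0, dotProduct]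
      refine eq_zero_of_mul_eq_trace_mul h.metric hx (R := R) (c := 3) (by norm_num)
        (by norm_num) (fun i j => ?_) i j
      have := quadratic_eq_zero (a := fun i j => t * a x i j - 3 * R i j) (fun z => ?_) i j
      · rw [hsymm j i, h.metric.symm x hx j i] at this
        linarith
      · have e := (key z).1
        simp only [hl, hB0, quad, hr] at e
        simp only [sub_mul, Finset.sum_sub_distrib, mul_assoc, ← Finset.mul_sum] at e ⊢
        linarith
    · obtain ⟨k, hk⟩ := not_forall.1 hb0
      refine eq_zero_of_mul_eq_trace_mul h.metric hx (R := R) (c := 1) (by norm_num)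
        (by norm_num) (fun i j => ?_) i j
      have hne : lin b x (EuclideanSpace.single k 1) ≠ 0 := by simpa [lin] using hk
      have hz := eq_zero_of_eventually_eq_zero (p := fun z => quad a x z * t - r z)
        (fun z => ((haq z).mul analyticAt_const).sub (har z))
        (((hal (EuclideanSpace.single k 1)).continuousAt.eventually_ne hne).mono fun z hz => by
          have := (key z).2
          exact (mul_eq_zero.1 ((mul_eq_zero.1 this).resolve_left (by norm_num))).resolve_left hz)
      have := quadratic_eq_zero (a := fun i j => t * a x i j - R i j) (fun z => ?_) i j
      · rw [hsymm j i, h.metric.symm x hx j i] at this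
        linarith
      · have e := hz z
        simp only [quad, hr] at e
        simp only [sub_mul, Finset.sum_sub_distrib, mul_assoc, ← Finset.mul_sum] at e ⊢
        linarith
  · intro y hxy
    have e := hv y hxy
    simp only [h.finslerRicciTensor_eq hB hxy, sub_mul, Finset.sum_sub_distrib] at e
    have e1 : ∑ i, ∑ j, 3 / f x y ^ 2 * (y i * y j) * ricci a i j x = 3 / f x y ^ 2 * r y := by
      simp only [hr, Finset.mul_sum]
      exact Finset.sum_congr rfl fun i _ => Finset.sum_congr rfl fun j _ => by ring
    have e2 := h.sum_inv_fundamentalTensor_mul hxy hsymm hRc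
    have hf := (h.pos hxy).ne'
    rw [e1, sub_eq_zero] at e
    rw [e] at e2
    have e3 : f x y ^ 3 * (3 / f x y ^ 2 * r y) = 3 * f x y * r y := by
      field_simp
    have hq := h.sqrt_mul_self hxy
    rw [e3, ← ht, ← hBdef, h.eq x y hxy] at e2
    have hr' : ∑ i, ∑ j, R i j * y i * y j = r y := rfl
    rw [hr'] at e2
    linear_combination (-1 : ℝ) * e2 - (√(quad a x y) + 2 * lin b x y) * t * hq

theorem vacuum_of_ricci_eq_zero (h : IsLocalRanders U D f a b) (hb : IsParallelOn U a b)
    (hR : ∀ i j, ricci a i j x = 0) (hxy : (x, y) ∈ D) :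
    ∑ i, ∑ j, ((fundamentalTensor f x y)⁻¹ i j -
      3 / f x y ^ 2 * (y i * y j)) * finslerRicciTensor f i j x y = 0 := by
  simp [h.finslerRicciTensor_eq (h.isBerwaldOn_of_parallel hb) hxy, hR]

end IsLocalRanders

/-! ### Passage to charts -/

section Linear

variable {V : Type*} [TopologicalSpace V] [AddCommGroup V] [Module ℝ V]

theorem linear_apply_eq_sum (T : Coord →L[ℝ] V) (y : Coord) :
    T y = ∑ i, y i • T (EuclideanSpace.single i 1) := by
  conv_lhs => rw [← (EuclideanSpace.basisFun (Fin 4) ℝ).sum_repr y]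
  simp

theorem form_apply_eq_sum (B : V →L[ℝ] V →L[ℝ] ℝ) (T : Coord →L[ℝ] V) (y z : Coord) :
    B (T y) (T z) = ∑ i, ∑ j,
      B (T (EuclideanSpace.single i 1)) (T (EuclideanSpace.single j 1)) * y i * z j := by
  rw [linear_apply_eq_sum T y, linear_apply_eq_sum T z]
  simp only [map_sum, map_smul, _root_.sum_apply, _root_.smul_apply,
    smul_eq_mul, Finset.mul_sum]
  rw [Finset.sum_comm]
  exact Finset.sum_congr rfl fun i _ => Finset.sum_congr rfl fun j _ => by ring

theorem det_ne_zero_of_nondegenerate (B : V →L[ℝ] V →L[ℝ] ℝ) (hs : ∀ v w, B v w = B w v)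
    (hB : ∀ v, (∀ w, B v w = 0) → v = 0) (T : Coord →L[ℝ] V) (hT : Function.Bijective T) :
    (Matrix.of fun i j : Fin 4 =>
      B (T (EuclideanSpace.single i 1)) (T (EuclideanSpace.single j 1))).det ≠ 0 := by
  intro h0
  obtain ⟨v, hv, hv0⟩ := Matrix.exists_mulVec_eq_zero_iff.2 h0
  refine hv ?_
  have h1 : T (WithLp.toLp 2 v) = 0 := by
    refine hB _ fun w => ?_
    obtain ⟨z, rfl⟩ := hT.2 w
    rw [hs, form_apply_eq_sum]
    refine Finset.sum_eq_zero fun i _ => ?_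
    rw [← mul_zero (z i), ← Pi.zero_apply (M := fun _ : Fin 4 => ℝ) i, ← hv0, Matrix.mulVec,
      dotProduct, Finset.mul_sum]
    exact Finset.sum_congr rfl fun j _ => by simp only [Matrix.of_apply]; ring
  have h2 : WithLp.toLp 2 v = (0 : Coord) := hT.1 (h1.trans (map_zero T).symm)
  ext i
  exact congrArg (fun y : Coord => y i) h2

end Linear

variable {M : Type*} [TopologicalSpace M] [ChartedSpace Coord M]

theorem mdifferentiable_of_mem_maximalAtlas [IsManifold (𝓡 4) ∞ M]
    {e : OpenPartialHomeomorph M Coord} (he : e ∈ IsManifold.maximalAtlas (𝓡 4) ∞ M) :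
    e.MDifferentiable (𝓡 4) (𝓡 4) :=
  ⟨(contMDiffOn_of_mem_maximalAtlas he).mdifferentiableOn (by simp),
    (contMDiffOn_symm_of_mem_maximalAtlas he).mdifferentiableOn (by simp)⟩

theorem mfderiv_symm_bijective [IsManifold (𝓡 4) ∞ M]
    {e : OpenPartialHomeomorph M Coord} (he : e ∈ IsManifold.maximalAtlas (𝓡 4) ∞ M)
    {x : Coord} (hx : x ∈ e.target) :
    Function.Bijective (mfderiv (𝓡 4) (𝓡 4) e.symm x) :=
  (mdifferentiable_of_mem_maximalAtlas he).symm.mfderiv_bijective hx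

/-- In the product model of the tangent bundle this is the tangent map of `e.symm`. It makes the
coordinate domain of `A` open. -/
theorem continuousOn_ofCoord [IsManifold (𝓡 4) ∞ M]
    {e : OpenPartialHomeomorph M Coord} (he : e ∈ IsManifold.maximalAtlas (𝓡 4) ∞ M) :
    ContinuousOn (fun p : Coord × Coord => ofCoord e p.1 p.2) (e.target ×ˢ Set.univ) := by
  have h := (contMDiffOn_symm_of_mem_maximalAtlas he).continuousOn_tangentMapWithin (by simp)
    e.open_target.uniqueMDiffOn
  have h2 := h.comp (tangentBundleModelSpaceHomeomorph (𝓡 4)).symm.continuous.continuousOn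
    (s := e.target ×ˢ (Set.univ : Set Coord)) (fun p hp => hp.1)
  refine h2.congr fun p hp => ?_
  rw [Function.comp_apply, tangentBundleModelSpaceHomeomorph_coe_symm]
  change _ = (⟨e.symm p.1, mfderivWithin (𝓡 4) (𝓡 4) e.symm e.target p.1 p.2⟩ :
    TangentBundle (𝓡 4) M)
  rw [mfderivWithin_of_isOpen e.open_target hp.1]
  rfl

/-- The coordinate expression in a chart of a Finsler spacetime of Randers type. -/
theorem isLocalRanders_inChart [IsManifold (𝓡 4) ∞ M] {A : Set (TangentBundle (𝓡 4) M)}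
    {F : TangentBundle (𝓡 4) M → ℝ} {a : PseudoRiemannianMetric M} {b : OneForm M}
    (hF : IsFinslerSpacetime A F) (hR : IsRanders A F a b) {e : OpenPartialHomeomorph M Coord}
    (he : e ∈ IsManifold.maximalAtlas (𝓡 4) ∞ M) :
    IsLocalRanders e.target {p | p.1 ∈ e.target ∧ ofCoord e p.1 p.2 ∈ A} (inChart e F)
      (a.components e) (b.components e) := by
  have hquad : ∀ x y, a.form (e.symm x) (mfderiv (𝓡 4) (𝓡 4) e.symm x y)
      (mfderiv (𝓡 4) (𝓡 4) e.symm x y) = quad (a.components e) x y := fun x y =>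
    form_apply_eq_sum (a.form (e.symm x)) (mfderiv (𝓡 4) (𝓡 4) e.symm x) y y
  have hlin : ∀ x y, b.form (e.symm x) (mfderiv (𝓡 4) (𝓡 4) e.symm x y) =
      lin (b.components e) x y := fun x y => by
    have h := linear_apply_eq_sum
      ((b.form (e.symm x)).comp (mfderiv (𝓡 4) (𝓡 4) e.symm x)) y
    refine h.trans (Finset.sum_congr rfl fun i _ => mul_comm _ _)
  refine ⟨⟨e.open_target, a.smooth e he, fun x _ i j => a.symm _ _ _, fun x hx => ?_⟩,
    b.smooth e he, ?_, fun p hp => hp.1, fun x hx => ?_, fun x y hxy => ?_, fun x y hxy => ?_,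
    fun x y hxy => hF.nonneg _ hxy.2, fun x y hxy => hF.lorentzian e he x hxy.1 y hxy.2⟩
  · exact det_ne_zero_of_nondegenerate (a.form (e.symm x)) (a.symm _) (a.nondegenerate _)
      (mfderiv (𝓡 4) (𝓡 4) e.symm x) (mfderiv_symm_bijective he hx)
  · have h := (continuousOn_ofCoord he).isOpen_inter_preimage (e.open_target.prod isOpen_univ)
      hF.isOpen
    convert h using 1
    ext p
    simp
  · obtain ⟨v, hv⟩ := hF.fiber_nonempty (e.symm x)
    obtain ⟨y, rfl⟩ := (mfderiv_symm_bijective he hx).2 v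
    exact ⟨y, hx, hv⟩
  · exact (hR _ _ hxy.2).1.trans_eq (hquad x y)
  · exact (hR _ _ hxy.2).2.trans (congrArg₂ (fun s t => √s + t) (hquad x y) (hlin x y))

end RandersSpacetime

/-! ### The equivalence on the manifold, chart by chart. -/

theorem mainTheorem4 {M : Type*} [TopologicalSpace M] [ChartedSpace RandersSpacetime.Coord M]
    [IsManifold (𝓡 4) ∞ M] (A : Set (TangentBundle (𝓡 4) M)) (F : TangentBundle (𝓡 4) M → ℝ)
    (a : RandersSpacetime.PseudoRiemannianMetric M) (b : RandersSpacetime.OneForm M)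
    (hF : RandersSpacetime.IsFinslerSpacetime A F)
    (hR : RandersSpacetime.IsRanders A F a b) :
    List.TFAE [
      RandersSpacetime.IsBerwald A F ∧ RandersSpacetime.SolvesFinslerVacuum A F,
      RandersSpacetime.SolvesEinsteinVacuum a ∧ RandersSpacetime.IsBerwald A F,
      RandersSpacetime.SolvesEinsteinVacuum a ∧ RandersSpacetime.IsParallel a b] := by
  have parallel : RandersSpacetime.IsBerwald A F → RandersSpacetime.IsParallel a b := by
    intro hB e he
    obtain ⟨Γ, hΓ⟩ := hB e he
    exact (RandersSpacetime.isLocalRanders_inChart hF hR he).isParallelOn_of_berwald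
      fun x y hxy => hΓ x hxy.1 y hxy.2
  tfae_have 1 → 2 := fun ⟨hB, hV⟩ => ⟨fun e he x hx =>
    (RandersSpacetime.isLocalRanders_inChart hF hR he).ricci_eq_zero_of_vacuum
      (parallel hB e he) hx fun y hxy => hV e he x hx y hxy.2, hB⟩
  tfae_have 2 → 3 := fun ⟨hE, hB⟩ => ⟨hE, parallel hB⟩
  tfae_have 3 → 1 := fun ⟨hE, hb⟩ =>
    ⟨fun e he => ⟨_, fun x hx y hxy =>
      (RandersSpacetime.isLocalRanders_inChart hF hR he).isBerwaldOn_of_parallel (hb e he) x y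
        ⟨hx, hxy⟩⟩,
    fun e he x hx y hxy =>
      (RandersSpacetime.isLocalRanders_inChart hF hR he).vacuum_of_ricci_eq_zero (hb e he)
        (hE e he x hx) ⟨hx, hxy⟩⟩
  tfae_finish
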